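/- Let $\Sigma$ be a finite alphabet, $\sharp\notin\Sigma$ an end-marker, and $k\ge 1$. A \emph{nondeterministic $k$-pass automaton} has a finite state set $Q$, an initial state $q_0\in Q$, a finite stack alphabet $\Gamma\supseteq\Sigma$, two halting states $H_a,H_n\notin Q$, and for each pass $j\in\{1,\dots,k\}$ a transition function assigning to $(j,q,\sigma,\gamma)\in\{1,\dots,k\}\times Q\times(\Sigma\cup\{\varepsilon\})\times(\Gamma\cup\{\varepsilon\})$ a finite subset of $Q\times\Gamma^*$. Here $\gamma$ is the top of the stack, with $\gamma=\varepsilon$ meaning that the stack is empty. If $(q',\zeta)\in\delta(j,q,\sigma,\gamma)$, then on pass $j$, in state $q$, with $\gamma$ on top of the stack, the machine may pass to state $q'$ and replace $\gamma$ by $\zeta$; when $\sigma\in\Sigma$ it does so by reading the letter $\sigma$ and advancing the tape, and when $\sigma=\varepsilon$ the reading head does not move. No $\varepsilon$-transition is possible when the stack is empty. In addition $\delta(j,q,\sharp,\gamma)\subseteq Q$ for $j<k$, and $\delta(k,q,\sharp,\gamma)\in\{H_a,H_n\}$. On reading $\sharp$ on pass $j<k$ the machine moves to some state in $\delta(j,q,\sharp,\gamma)$,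 empties its stack, returns to the beginning of the input and starts pass $j+1$; on reading $\sharp$ on pass $k$ it halts in state $\delta(k,q,\sharp,\gamma)$. It accepts $w\in\Sigma^*$ if some computation on $w\sharp$, started on pass $1$ in state $q_0$ with empty stack, halts in $H_a$. A \emph{deterministic $k$-pass automaton} is defined in the same way, with $H_n$ replaced by a rejecting state $H_r$, except that each $\delta(j,q,\sigma,\gamma)$ with $\sigma\in\Sigma\cup\{\varepsilon\}$ has at most one element and each $\delta(j,q,\sharp,\gamma)$ with $j<k$ is a single state; if $\delta(j,q,\varepsilon,\gamma)\ne\emptyset$ then $\delta(j,q,\sigma,\gamma)=\emptyset$ for all $\sigma\in\Sigma$, and if $\delta(j,q,\varepsilon,\gamma)=\emptyset$ then $\delta(j,q,\sigma,\gamma)\neq\emptyset$ for all $\sigma\in\Sigma$; and the machine reads $\sharp$ only when no $\varepsilon$-transition is available. Let $\mathcal{DM}$ (respectively $\mathcal{NM}$) be the class of languages $L\subseteq\Sigma^*$ accepted by a deterministic (respectively nondeterministic) $k$-pass automaton for some $k\ge1$. A language is deterministic context-free if it is accepted by final state by a deterministic pushdown automaton. \textbf{Theorem.} For every finite alphabet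 $\Sigma$: (1) $\mathcal{DM}$ is the Boolean closure of the class of deterministic context-free languages over $\Sigma$, that is, the smallest class of subsets of $\Sigma^*$ that contains these languages and is closed under union, intersection and complementation in $\Sigma^*$. (2) $\mathcal{NM}$ is the class of poly-context-free languages over $\Sigma$, that is, of intersections $L_1\cap\dots\cap L_m$, $m\ge1$, of finitely many context-free languages over $\Sigma$. -/

import Mathlib

/-! ### Deterministic pushdown automata and deterministic context-free languages -/

/-- A deterministic pushdown automaton with input alphabet `T`, state set `Q`, stack alphabet `Γ`.
In `δ q a γ` the argument `a = none` stands for an `ε`-move, and the value `none` for an undefined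
transition. Words over `Γ` are written with the top of the stack first. -/
structure DetPushdown (T Q Γ : Type*) where
  /-- the partial transition function -/
  δ : Q → Option T → Γ → Option (Q × List Γ)
  /-- the initial state -/
  start : Q
  /-- the symbol initially on the stack -/
  bottom : Γ
  /-- the set of final states -/
  final : Set Q
  /-- there is never a choice between an `ε`-move and reading a letter -/
  deterministic : ∀ q γ, (δ q none γ).isSome → ∀ σ : T, δ q (some σ) γ = none

namespace DetPushdown

variable {T Q Γ : Type*}

/-- One move between configurations (state, unread input, stack). There is no move when the stack
is empty. -/
inductive Step (M : DetPushdown T Q Γ) :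
    Q × List T × List Γ → Q × List T × List Γ → Prop
  | read {q q' : Q} {σ : T} {u : List T} {γ : Γ} {s ζ : List Γ}
      (h : M.δ q (some σ) γ = some (q', ζ)) :
      Step M (q, σ :: u, γ :: s) (q', u, ζ ++ s)
  | eps {q q' : Q} {u : List T} {γ : Γ} {s ζ : List Γ}
      (h : M.δ q none γ = some (q', ζ)) :
      Step M (q, u, γ :: s) (q', u, ζ ++ s)

/-- The language accepted by final state. -/
def language (M : DetPushdown T Q Γ) : Language T :=
  {w | ∃ q ∈ M.final, ∃ s : List Γ,
    Relation.ReflTransGen M.Step (M.start, w, [M.bottom]) (q, [], s)}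

end DetPushdown

/-- A language is deterministic context-free if some deterministic pushdown automaton with finitely
many states and stack symbols accepts it by final state. -/
def IsDetContextFree {T : Type*} (L : Language T) : Prop :=
  ∃ (Q Γ : Type) (_ : Finite Q) (_ : Finite Γ) (M : DetPushdown T Q Γ), M.language = L

/-! ### Multipass automata

An automaton with `n + 1` passes has its passes numbered by `Fin (n + 1)`; the nonfinal ones are
`j.castSucc` for `j : Fin n`, the final one is `Fin.last n`. The tape holds `w♯`; the unread part of
the tape is recorded without `♯`, so that `[]` means that the head stands on the end-marker. Elements
of `Option T` and `Option Γ` are letters or `ε` (`none`); as a top of the stack, `none` means that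
the stack is empty. Words over `Γ` are written with the top of the stack first. -/

/-- Configurations during a run: either running (pass, state, unread input, stack), or halted in
one of the halting states `H`. -/
inductive MultipassConfig (T Q Γ H : Type*) (n : ℕ)
  | running (j : Fin (n + 1)) (q : Q) (u : List T) (s : List Γ)
  | halted (h : H)

/-- The halting states of a deterministic multipass automaton. -/
inductive DetHalt
  | accept
  | reject

/-- A deterministic multipass automaton with `n + 1` passes, input alphabet `T`, state set `Q` and
stack alphabet `Γ`. -/
structure DetMultipass (T Q Γ : Type*) (n : ℕ) where
  /-- the input alphabet is contained in the stack alphabet -/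
  incl : T ↪ Γ
  /-- the initial state -/
  start : Q
  /-- the transitions not reading the end-marker; the value `none` means no transition -/
  δ : Fin (n + 1) → Q → Option T → Option Γ → Option (Q × List Γ)
  /-- if there is an `ε`-transition then no transition reads a letter -/
  deterministic : ∀ j q γ, (δ j q none γ).isSome → ∀ σ : T, δ j q (some σ) γ = none
  /-- there is always an `ε`-transition or a transition reading the input letter -/
  total : ∀ j q γ (σ : T), (δ j q none γ).isSome ∨ (δ j q (some σ) γ).isSome
  /-- no `ε`-transition is possible when the stack is empty -/
  eps_empty : ∀ j q, δ j q none none = none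
  /-- reading the end-marker on a nonfinal pass -/
  δNext : Fin n → Q → Option Γ → Q
  /-- reading the end-marker on the final pass -/
  δLast : Q → Option Γ → DetHalt

namespace DetMultipass

variable {T Q Γ : Type*} {n : ℕ}

/-- One move on the input `w`. As an `ε`-transition is made independently of the symbol under the
head and the machine never has a choice, the end-marker is read only when there is no
`ε`-transition. -/
inductive Step (M : DetMultipass T Q Γ n) (w : List T) :
    MultipassConfig T Q Γ DetHalt n → MultipassConfig T Q Γ DetHalt n → Prop
  | read {j : Fin (n + 1)} {q q' : Q} {σ : T} {u : List T} {s ζ : List Γ}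
      (h : M.δ j q (some σ) s.head? = some (q', ζ)) :
      Step M w (.running j q (σ :: u) s) (.running j q' u (ζ ++ s.tail))
  | eps {j : Fin (n + 1)} {q q' : Q} {u : List T} {s ζ : List Γ}
      (h : M.δ j q none s.head? = some (q', ζ)) :
      Step M w (.running j q u s) (.running j q' u (ζ ++ s.tail))
  | nextPass {j : Fin n} {q : Q} {s : List Γ}
      (h : M.δ j.castSucc q none s.head? = none) :
      Step M w (.running j.castSucc q [] s) (.running j.succ (M.δNext j q s.head?) w [])
  | halt {q : Q} {s : List Γ}
      (h : M.δ (Fin.last n) q none s.head? = none) :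
      Step M w (.running (Fin.last n) q [] s) (.halted (M.δLast q s.head?))

/-- The language accepted by a deterministic multipass automaton. -/
def language (M : DetMultipass T Q Γ n) : Language T :=
  {w | Relation.ReflTransGen (M.Step w) (.running 0 M.start w []) (.halted .accept)}

end DetMultipass

/-- Deterministic multipass languages: those accepted by a deterministic `k`-pass automaton, with
finitely many states and stack symbols, for some `k = n + 1 ≥ 1`. -/
def IsDetMultipass {T : Type*} (L : Language T) : Prop :=
  ∃ (n : ℕ) (Q Γ : Type) (_ : Finite Q) (_ : Finite Γ) (M : DetMultipass T Q Γ n), M.language = L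

/-- The halting states of a nondeterministic multipass automaton. -/
inductive NondetHalt
  | accept
  | noDecision

/-- A nondeterministic multipass automaton with `n + 1` passes, input alphabet `T`, state set `Q`
and stack alphabet `Γ`. -/
structure NondetMultipass (T Q Γ : Type*) (n : ℕ) where
  /-- the input alphabet is contained in the stack alphabet -/
  incl : T ↪ Γ
  /-- the initial state -/
  start : Q
  /-- the finitely many possible transitions not reading the end-marker -/
  δ : Fin (n + 1) → Q → Option T → Option Γ → Finset (Q × List Γ)
  /-- no `ε`-transition is possible when the stack is empty -/
  eps_empty : ∀ j q, δ j q none none = ∅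
  /-- the possible states after reading the end-marker on a nonfinal pass -/
  δNext : Fin n → Q → Option Γ → Set Q
  /-- reading the end-marker on the final pass -/
  δLast : Q → Option Γ → NondetHalt

namespace NondetMultipass

variable {T Q Γ : Type*} {n : ℕ}

/-- One possible move on the input `w`. -/
inductive Step (M : NondetMultipass T Q Γ n) (w : List T) :
    MultipassConfig T Q Γ NondetHalt n → MultipassConfig T Q Γ NondetHalt n → Prop
  | read {j : Fin (n + 1)} {q q' : Q} {σ : T} {u : List T} {s ζ : List Γ}
      (h : (q', ζ) ∈ M.δ j q (some σ) s.head?) :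
      Step M w (.running j q (σ :: u) s) (.running j q' u (ζ ++ s.tail))
  | eps {j : Fin (n + 1)} {q q' : Q} {u : List T} {s ζ : List Γ}
      (h : (q', ζ) ∈ M.δ j q none s.head?) :
      Step M w (.running j q u s) (.running j q' u (ζ ++ s.tail))
  | nextPass {j : Fin n} {q q' : Q} {s : List Γ}
      (h : q' ∈ M.δNext j q s.head?) :
      Step M w (.running j.castSucc q [] s) (.running j.succ q' w [])
  | halt {q : Q} {s : List Γ} :
      Step M w (.running (Fin.last n) q [] s) (.halted (M.δLast q s.head?))

/-- The language accepted by a nondeterministic multipass automaton: some computation accepts. -/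
def language (M : NondetMultipass T Q Γ n) : Language T :=
  {w | Relation.ReflTransGen (M.Step w) (.running 0 M.start w []) (.halted .accept)}

end NondetMultipass

/-- Nondeterministic multipass languages: those accepted by a nondeterministic `k`-pass automaton,
with finitely many states and stack symbols, for some `k = n + 1 ≥ 1`. -/
def IsNondetMultipass {T : Type*} (L : Language T) : Prop :=
  ∃ (n : ℕ) (Q Γ : Type) (_ : Finite Q) (_ : Finite Γ) (M : NondetMultipass T Q Γ n),
    M.language = L

/-- Poly-context-free languages: intersections of finitely many (at least one) context-free
languages. -/
def IsPolyContextFree {T : Type*} (L : Language T) : Prop :=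
  ∃ (m : ℕ) (F : Fin (m + 1) → Language T), (∀ i, (F i).IsContextFree) ∧ L = ⨅ i, F i

/-! Between two passes a multipass automaton forgets everything but its state: the stack is emptied
and the head returns to the start. Hence the words accepted from state `q` at the start of pass `j`
form a finite union over the states `q'`. The term for `q'` is the intersection of the words on
which pass `j`, started in `q`, can hand over to `q'` with the words accepted from `q'` at the start
of the next pass. A single pass (`PassRun`) is a pushdown computation, so the first factor is
context-free, respectively deterministic context-free. Downward induction on the pass then shows
that machines accept only the claimed languages (`NondetMultipass.isPolyContextFree_from`,
`DetMultipass.mem_closure_from`). In the nondeterministic case this needs closure of the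
poly-context-free languages under finite unions, which follows from distributivity and closure of
context-free languages under union.

Conversely, an intersection of context-free languages is accepted by running one top-down parser per
pass, each handing over only on success. Context-free grammars and pushdown runs are matched through
leftmost derivations and, in the direction from runs to grammars, the triple construction
(`yields_popRules_iff`).

A Boolean combination of deterministic context-free languages requires passes that decide membership
and always reach the end-marker, whereas a pushdown automaton may block, exhaust its stack or make
`ε`-moves forever. The remedy (`DetPushdown.decider`) is to stop as soon as the `ε`-moves from the
current state with only the top symbol on the stack would never end. From there no letter is ever
read and nothing below the top is ever reached, so the answer depends only on state and top symbol.
The machine `PassDecider.combine` collects the answers of its passes in its state and applies the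
Boolean function at the last end-marker. -/

/-! ### Leftmost derivations -/

/-- `Yields R α w`: the sentential form `α` derives the word `w` by leftmost derivations using the
rules in `R`. -/
inductive Yields {T N : Type*} (R : Set (ContextFreeRule T N)) :
    List (Symbol T N) → List T → Prop
  | nil : Yields R [] []
  | terminal {σ : T} {α : List (Symbol T N)} {u : List T} :
      Yields R α u → Yields R (.terminal σ :: α) (σ :: u)
  | nonterminal {r : ContextFreeRule T N} {α : List (Symbol T N)} {u : List T} :
      r ∈ R → Yields R (r.output ++ α) u → Yields R (.nonterminal r.input :: α) u

namespace Yields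

variable {T N : Type*} {R : Set (ContextFreeRule T N)}

theorem append {α β : List (Symbol T N)} {u v : List T} (h : Yields R α u) (h' : Yields R β v) :
    Yields R (α ++ β) (u ++ v) := by
  induction h with
  | nil => exact h'
  | terminal _ ih => exact .terminal ih
  | nonterminal hr _ ih => exact .nonterminal hr (by simpa using ih)

theorem exists_of_append {α β : List (Symbol T N)} {w : List T} (h : Yields R (α ++ β) w) :
    ∃ u v, w = u ++ v ∧ Yields R α u ∧ Yields R β v := by
  generalize hγ : α ++ β = γ at h
  induction h generalizing α with
  | nil =>
    obtain ⟨rfl, rfl⟩ := List.append_eq_nil_iff.1 hγ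
    exact ⟨[], [], rfl, .nil, .nil⟩
  | @terminal σ γ u h ih =>
    cases α with
    | nil => exact ⟨[], σ :: u, rfl, .nil, by subst hγ; exact .terminal h⟩
    | cons x α =>
      obtain ⟨rfl, rfl⟩ : x = .terminal σ ∧ α ++ β = γ := by simpa using hγ
      obtain ⟨u, v, rfl, h1, h2⟩ := ih rfl
      exact ⟨σ :: u, v, rfl, .terminal h1, h2⟩
  | @nonterminal r γ u hr h ih =>
    cases α with
    | nil => exact ⟨[], u, rfl, .nil, by subst hγ; exact .nonterminal hr h⟩
    | cons x α =>
      obtain ⟨rfl, rfl⟩ : x = .nonterminal r.input ∧ α ++ β = γ := by simpa using hγ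
      obtain ⟨u, v, rfl, h1, h2⟩ := ih (α := r.output ++ α) (by simp)
      exact ⟨u, v, rfl, .nonterminal hr h1, h2⟩

theorem map_terminal (w : List T) : Yields R (w.map Symbol.terminal) w := by
  induction w with
  | nil => exact .nil
  | cons σ w ih => exact .terminal ih

theorem of_rule {r : ContextFreeRule T N} (hr : r ∈ R) {w : List T} (h : Yields R r.output w) :
    Yields R [.nonterminal r.input] w :=
  .nonterminal hr (by simpa using h)

end Yields

namespace ContextFreeGrammar

variable {T : Type*} (g : ContextFreeGrammar T)

theorem derives_of_yields {α : List (Symbol T g.NT)} {w : List T}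
    (h : Yields (g.rules : Set (ContextFreeRule T g.NT)) α w) :
    g.Derives α (w.map Symbol.terminal) := by
  induction h with
  | nil => exact .refl _
  | terminal _ ih => exact ih.append_left [_]
  | nonterminal hr _ ih => exact Produces.trans_derives ⟨_, hr, .head _⟩ ih

/-- Induction from the first step of the derivation. The sentential form after that step splits
around the output of the rule, and the derived word splits with it, so the rule can be postponed
until its nonterminal is leftmost. -/
theorem yields_of_derives {α : List (Symbol T g.NT)} {w : List T}
    (h : g.Derives α (w.map Symbol.terminal)) :
    Yields (g.rules : Set (ContextFreeRule T g.NT)) α w := by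
  induction h using Relation.ReflTransGen.head_induction_on with
  | refl => exact .map_terminal w
  | head h _ ih =>
    obtain ⟨r, hr, h⟩ := h
    obtain ⟨p, q, rfl, rfl⟩ := h.exists_parts
    obtain ⟨u, v, rfl, h1, h2⟩ := ih.exists_of_append
    obtain ⟨u, u', rfl, h0, h1⟩ := h1.exists_of_append
    exact (h0.append (.of_rule hr h1)).append h2

theorem mem_language_iff_yields (w : List T) :
    w ∈ g.language ↔
      Yields (g.rules : Set (ContextFreeRule T g.NT)) [.nonterminal g.initial] w :=
  ⟨g.yields_of_derives, g.derives_of_yields⟩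

end ContextFreeGrammar

theorem isContextFree_of_yields {T : Type*} {N : Type} {R : Set (ContextFreeRule T N)}
    (hR : R.Finite) (A : N) {L : Language T} (hL : ∀ w, w ∈ L ↔ Yields R [.nonterminal A] w) :
    L.IsContextFree := by
  refine ⟨⟨N, A, hR.toFinset⟩, ?_⟩
  ext w
  rw [ContextFreeGrammar.mem_language_iff_yields, Set.Finite.coe_toFinset, hL]

/-- The words obtained from a sentential form by substituting words of the language `D A` for each
occurrence of the nonterminal `A`. -/
def Symbol.Subst {T N : Type*} (D : N → List T → Prop) : List (Symbol T N) → List T → Prop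
  | [], w => w = []
  | .terminal σ :: α, w => ∃ v, w = σ :: v ∧ Symbol.Subst D α v
  | .nonterminal A :: α, w => ∃ u v, w = u ++ v ∧ D A u ∧ Symbol.Subst D α v

namespace Symbol

variable {T N : Type*} {D : N → List T → Prop}

theorem Subst.exists_of_append {α β : List (Symbol T N)} {w : List T}
    (h : Symbol.Subst D (α ++ β) w) :
    ∃ u v, w = u ++ v ∧ Symbol.Subst D α u ∧ Symbol.Subst D β v := by
  induction α generalizing w with
  | nil => exact ⟨[], w, rfl, rfl, h⟩
  | cons x α ih =>
    cases x with
    | terminal σ =>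
      obtain ⟨v, rfl, h⟩ := h
      obtain ⟨u, v, rfl, h1, h2⟩ := ih h
      exact ⟨σ :: u, v, rfl, ⟨u, rfl, h1⟩, h2⟩
    | nonterminal A =>
      obtain ⟨u', v, rfl, hA, h⟩ := h
      obtain ⟨u, v, rfl, h1, h2⟩ := ih h
      exact ⟨u' ++ u, v, by simp, ⟨u', u, rfl, hA, h1⟩, h2⟩

/-- Derivations are sound for any family of languages satisfying the rules. -/
theorem subst_of_yields {R : Set (ContextFreeRule T N)}
    (hD : ∀ r ∈ R, ∀ w, Symbol.Subst D r.output w → D r.input w)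
    {α : List (Symbol T N)} {w : List T} (h : Yields R α w) : Symbol.Subst D α w := by
  induction h with
  | nil => rfl
  | terminal _ ih => exact ⟨_, rfl, ih⟩
  | nonterminal hr _ ih =>
    obtain ⟨u, v, rfl, h1, h2⟩ := ih.exists_of_append
    exact ⟨u, v, rfl, hD _ hr _ h1, h2⟩

theorem of_yields_nonterminal {R : Set (ContextFreeRule T N)}
    (hD : ∀ r ∈ R, ∀ w, Symbol.Subst D r.output w → D r.input w)
    {A : N} {w : List T} (h : Yields R [.nonterminal A] w) : D A w := by
  obtain ⟨u, v, rfl, hA, rfl⟩ := subst_of_yields hD h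
  simpa using hA

/-- Renaming of nonterminals. -/
def mapNT {M : Type*} (f : N → M) : Symbol T N → Symbol T M
  | .terminal σ => .terminal σ
  | .nonterminal A => .nonterminal (f A)

theorem subst_of_yields_map {M : Type*} {R : Set (ContextFreeRule T N)} (f : N → M)
    {E : M → List T → Prop} {α : List (Symbol T N)} {w : List T}
    (hE : ∀ A w, E (f A) w → Yields R [.nonterminal A] w)
    (h : Symbol.Subst E (α.map (mapNT f)) w) : Yields R α w := by
  induction α generalizing w with
  | nil => obtain rfl : w = [] := h; exact .nil
  | cons x α ih =>
    cases x with
    | terminal σ => obtain ⟨v, rfl, h⟩ := h; exact .terminal (ih h)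
    | nonterminal A => obtain ⟨u, v, rfl, hA, h⟩ := h; exact (hE A u hA).append (ih h)

end Symbol

theorem Yields.map {T N M : Type*} {R : Set (ContextFreeRule T N)} {R' : Set (ContextFreeRule T M)}
    (f : N → M) (hR : ∀ r ∈ R, ⟨f r.input, r.output.map (Symbol.mapNT f)⟩ ∈ R')
    {α : List (Symbol T N)} {w : List T} (h : Yields R α w) :
    Yields R' (α.map (Symbol.mapNT f)) w := by
  induction h with
  | nil => exact .nil
  | terminal _ ih => exact .terminal ih
  | nonterminal hr _ ih => exact .nonterminal (hR _ hr) (by simpa using ih)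

theorem Language.IsContextFree.sup {T : Type*} {L L' : Language T} (hL : L.IsContextFree)
    (hL' : L'.IsContextFree) : (L ⊔ L').IsContextFree := by
  obtain ⟨g, rfl⟩ := hL
  obtain ⟨g', rfl⟩ := hL'
  let f : g.NT → Option (g.NT ⊕ g'.NT) := fun A => some (.inl A)
  let f' : g'.NT → Option (g.NT ⊕ g'.NT) := fun A => some (.inr A)
  let R : Set (ContextFreeRule T (Option (g.NT ⊕ g'.NT))) :=
    {⟨none, [.nonterminal (f g.initial)]⟩, ⟨none, [.nonterminal (f' g'.initial)]⟩} ∪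
      ((fun r : ContextFreeRule T g.NT => ⟨f r.input, r.output.map (Symbol.mapNT f)⟩) '' (g.rules : Set _) ∪
        (fun r : ContextFreeRule T g'.NT => ⟨f' r.input, r.output.map (Symbol.mapNT f')⟩) '' (g'.rules : Set _))
  have hR : R.Finite := (Set.toFinite _).union
    ((g.rules.finite_toSet.image _).union (g'.rules.finite_toSet.image _))
  refine isContextFree_of_yields hR none fun w => ?_
  -- The intended language of each nonterminal. It satisfies all rules, so nothing else is
  -- derivable.
  let D : Option (g.NT ⊕ g'.NT) → List T → Prop
    | none, w => w ∈ g.language ∨ w ∈ g'.language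
    | some (.inl A), w => Yields (g.rules : Set _) [.nonterminal A] w
    | some (.inr A), w => Yields (g'.rules : Set _) [.nonterminal A] w
  constructor
  · rintro (h | h)
    · have h1 := ((g.mem_language_iff_yields w).1 h).map f (R' := R)
        fun r hr => .inr (.inl ⟨r, hr, rfl⟩)
      exact Yields.of_rule (r := ⟨none, [.nonterminal (f g.initial)]⟩) (.inl (.inl rfl)) h1
    · have h1 := ((g'.mem_language_iff_yields w).1 h).map f' (R' := R)
        fun r hr => .inr (.inr ⟨r, hr, rfl⟩)
      exact Yields.of_rule (r := ⟨none, [.nonterminal (f' g'.initial)]⟩) (.inl (.inr rfl)) h1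
  · intro h
    refine Symbol.of_yields_nonterminal (D := D) ?_ h
    rintro r ((rfl | rfl) | (⟨r, hr, rfl⟩ | ⟨r, hr, rfl⟩)) w hw
    · obtain ⟨u, v, rfl, hu, rfl⟩ := hw
      exact .inl ((g.mem_language_iff_yields _).2 (by simpa using hu))
    · obtain ⟨u, v, rfl, hu, rfl⟩ := hw
      exact .inr ((g'.mem_language_iff_yields _).2 (by simpa using hu))
    · exact .of_rule hr (Symbol.subst_of_yields_map f (fun A w h => h) hw)
    · exact .of_rule hr (Symbol.subst_of_yields_map f' (fun A w h => h) hw)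

/-- A grammar without rules derives no word. This supplies the empty union in
`IsPolyContextFree.iSup`. -/
theorem isContextFree_bot {T : Type*} : (⊥ : Language T).IsContextFree := by
  refine isContextFree_of_yields (T := T) (R := ∅) Set.finite_empty () fun w => ?_
  refine ⟨False.elim, fun h => ?_⟩
  exact Symbol.of_yields_nonterminal (D := fun _ _ => False) (by simp) h

/-! ### Pushdown machines consuming their stack -/

/-- `PopRun e q p s w`: a pushdown machine with moves `e`, started in state `p` with stack `s`, can
read `w` and empty its stack, arriving in state `q`. -/
inductive PopRun {T P A : Type*} (e : P → Option T → A → P → List A → Prop) (q : P) :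
    P → List A → List T → Prop
  | done : PopRun e q q [] []
  | step {p p' : P} {a : Option T} {x : A} {η s : List A} {w : List T} :
      e p a x p' η → PopRun e q p' (η ++ s) w → PopRun e q p (x :: s) (a.toList ++ w)

/-- The same as `PopRun`, with the run cut into pieces that pop one symbol each. -/
inductive PopTree {T P A : Type*} (e : P → Option T → A → P → List A → Prop) :
    P → List A → P → List T → Prop
  | done (p : P) : PopTree e p [] p []
  | step {p p' r q : P} {a : Option T} {x : A} {η s : List A} {u v : List T} :
      e p a x p' η → PopTree e p' η r u → PopTree e r s q v →
        PopTree e p (x :: s) q (a.toList ++ (u ++ v))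

section PopRun

variable {T P A : Type*} {e : P → Option T → A → P → List A → Prop}

theorem PopRun.append {p r q : P} {s t : List A} {u v : List T} (h : PopRun e r p s u)
    (h' : PopRun e q r t v) : PopRun e q p (s ++ t) (u ++ v) := by
  induction h with
  | done => exact h'
  | step he _ ih => simpa using PopRun.step he (by simpa using ih)

theorem PopTree.exists_of_append {p q : P} {s t : List A} {w : List T}
    (h : PopTree e p (s ++ t) q w) :
    ∃ r u v, w = u ++ v ∧ PopTree e p s r u ∧ PopTree e r t q v := by
  induction s generalizing p w with
  | nil => exact ⟨p, [], w, rfl, .done p, h⟩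
  | cons x s ih =>
    cases h with
    | step he h1 h2 =>
      obtain ⟨r, u, v, rfl, h3, h4⟩ := ih h2
      exact ⟨r, _, v, by simp, .step he h1 h3, h4⟩

/-- Runs are what a machine produces; trees are what a grammar produces. A run that empties `s ++ t`
has a moment at which `s` has just been consumed, and cutting there repeatedly gives the tree. -/
theorem popTree_iff {p q : P} {s : List A} {w : List T} :
    PopTree e p s q w ↔ PopRun e q p s w := by
  constructor
  · intro h
    induction h with
    | done p => exact .done
    | step he _ _ ih1 ih2 => exact .step he (ih1.append ih2)
  · intro h
    induction h with
    | done => exact .done _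
    | step he _ ih =>
      obtain ⟨r, u, v, rfl, h1, h2⟩ := ih.exists_of_append
      exact .step he h1 h2

/-- The rules of the grammar describing the runs of a pushdown machine; the nonterminal `(p, s, q)`
stands for the words read while consuming the stack `s` from state `p`, ending in state `q`. The
stacks are restricted to `S`. -/
def popRules (e : P → Option T → A → P → List A → Prop) (S : Set (List A)) :
    Set (ContextFreeRule T (P × List A × P)) :=
  Set.range (fun p => ⟨(p, [], p), []⟩) ∪
    (fun z : (P × Option T × A × P × List A) × List A × P × P =>
      ⟨(z.1.1, z.1.2.2.1 :: z.2.1, z.2.2.2), z.1.2.1.toList.map Symbol.terminal ++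
        [.nonterminal (z.1.2.2.2.1, z.1.2.2.2.2, z.2.2.1),
          .nonterminal (z.2.2.1, z.2.1, z.2.2.2)]⟩) ''
      ({z : P × Option T × A × P × List A | e z.1 z.2.1 z.2.2.1 z.2.2.2.1 z.2.2.2.2} ×ˢ S ×ˢ Set.univ)

/-- The triple construction. The hypotheses on `S` keep every stack piece occurring in a tree inside
`S`, so that a finite `S` gives finitely many rules. -/
theorem yields_popRules_iff {S : Set (List A)} (hS : ∀ x s, x :: s ∈ S → s ∈ S)
    (heS : ∀ p a x p' η, e p a x p' η → η ∈ S) {p q : P} {s : List A} (hs : s ∈ S)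
    {w : List T} :
    Yields (popRules e S) [.nonterminal (p, s, q)] w ↔ PopRun e q p s w := by
  rw [← popTree_iff]
  constructor
  · refine Symbol.of_yields_nonterminal
      (D := fun (z : P × List A × P) w => PopTree e z.1 z.2.1 z.2.2 w) ?_
    rintro r (⟨p, rfl⟩ | ⟨⟨⟨p, a, x, p', η⟩, s, r, q⟩, ⟨he, -⟩, rfl⟩) w hw
    · obtain rfl : w = [] := hw
      exact .done p
    · obtain ⟨t, w, rfl, ht, u, w, rfl, hu, v, w, rfl, hv, rfl⟩ := hw.exists_of_append
      obtain rfl : t = a.toList := by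
        cases a with
        | none => exact ht
        | some σ => obtain ⟨_, rfl, rfl⟩ := ht; rfl
      simpa using PopTree.step he hu hv
  · intro h
    induction h with
    | done p => exact .of_rule (r := ⟨(p, [], p), []⟩) (.inl ⟨p, rfl⟩) .nil
    | @step p p' r q a x η s u v he h1 h2 ih1 ih2 =>
      refine .of_rule (r := ⟨(p, x :: s, q), a.toList.map Symbol.terminal ++
        [.nonterminal (p', η, r), .nonterminal (r, s, q)]⟩)
        (.inr ⟨((p, a, x, p', η), s, r, q), ⟨he, hS _ _ hs, trivial⟩, rfl⟩) ?_
      exact (Yields.map_terminal _).append ((ih1 (heS _ _ _ _ _ he)).append (ih2 (hS _ _ hs)))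

end PopRun

theorem isContextFree_of_popRun {T : Type*} {P A : Type} [Finite P]
    {e : P → Option T → A → P → List A → Prop}
    (he : {z : P × Option T × A × P × List A | e z.1 z.2.1 z.2.2.1 z.2.2.2.1 z.2.2.2.2}.Finite)
    (p q : P) (s : List A) {L : Language T} (hL : ∀ w, w ∈ L ↔ PopRun e q p s w) :
    L.IsContextFree := by
  -- The suffixes of the initial stack and of the words pushed by moves: finitely many, and closed
  -- under removing the top.
  let S : Set (List A) := {t | t <:+ s} ∪ ⋃ z ∈ {z : P × Option T × A × P × List A |
    e z.1 z.2.1 z.2.2.1 z.2.2.2.1 z.2.2.2.2}, {t | t <:+ z.2.2.2.2}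
  have suff (l : List A) : {t | t <:+ l}.Finite :=
    (List.finite_toSet l.tails).subset fun t ht => (List.mem_tails ..).2 ht
  have hSf : S.Finite := (suff s).union (he.biUnion fun z _ => suff _)
  have hS : ∀ x t, x :: t ∈ S → t ∈ S := by
    rintro x t (h | h)
    · exact .inl ((List.suffix_cons x t).trans h)
    · obtain ⟨z, hz, h⟩ := Set.mem_iUnion₂.1 h
      exact .inr (Set.mem_iUnion₂.2 ⟨z, hz, (List.suffix_cons x t).trans h⟩)
  have heS : ∀ p a x p' η, e p a x p' η → η ∈ S := fun p a x p' η h =>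
    .inr (Set.mem_iUnion₂.2 ⟨(p, a, x, p', η), h, List.suffix_rfl⟩)
  have hf : (popRules e S).Finite :=
    (Set.finite_range _).union ((he.prod (hSf.prod Set.finite_univ)).image _)
  exact isContextFree_of_yields hf (p, s, q) fun w => by
    rw [hL, yields_popRules_iff hS heS (.inl List.suffix_rfl)]

/-! ### A single pass -/

/-- `PassRun d fin q s u`: with moves `d`, started in state `q` with stack `s`, the machine can read
`u` and then be in a state and have a top of the stack satisfying `fin`. -/
inductive PassRun {T Q Γ : Type*} (d : Q → Option T → Option Γ → Q → List Γ → Prop)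
    (fin : Q → Option Γ → Prop) : Q → List Γ → List T → Prop
  | finish {q : Q} {s : List Γ} : fin q s.head? → PassRun d fin q s []
  | read {q q' : Q} {σ : T} {s ζ : List Γ} {u : List T} :
      d q (some σ) s.head? q' ζ → PassRun d fin q' (ζ ++ s.tail) u → PassRun d fin q s (σ :: u)
  | eps {q q' : Q} {s ζ : List Γ} {u : List T} :
      d q none s.head? q' ζ → PassRun d fin q' (ζ ++ s.tail) u → PassRun d fin q s u

theorem PassRun.mono {T Q Γ : Type*} {d : Q → Option T → Option Γ → Q → List Γ → Prop}
    {fin fin' : Q → Option Γ → Prop} (hfin : ∀ q γ, fin q γ → fin' q γ) {q : Q} {s : List Γ}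
    {u : List T} (h : PassRun d fin q s u) : PassRun d fin' q s u := by
  induction h with
  | finish h => exact .finish (hfin _ _ h)
  | read hd _ ih => exact .read hd ih
  | eps hd _ ih => exact .eps hd ih

section PopMoves

variable {T Q Γ : Type*}

/-- The moves of a machine that simulates a pass above a bottom marker `none`, and empties its stack
after the pass. -/
inductive PopMoves (d : Q → Option T → Option Γ → Q → List Γ → Prop) (fin : Q → Option Γ → Prop) :
    Option Q → Option T → Option Γ → Option Q → List (Option Γ) → Prop
  | move {q q' : Q} {a : Option T} {γ : Option Γ} {ζ : List Γ} (h : d q a γ q' ζ) :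
      PopMoves d fin (some q) a γ (some q') (ζ.map some ++ if γ = none then [none] else [])
  | finish {q : Q} {γ : Option Γ} (h : fin q γ) : PopMoves d fin (some q) none γ none []
  | pop (γ : Option Γ) : PopMoves d fin none none γ none []

variable {d : Q → Option T → Option Γ → Q → List Γ → Prop} {fin : Q → Option Γ → Prop}

theorem popMoves_finite [Finite T] [Finite Q] [Finite Γ]
    (hd : ∀ q a γ, {z : Q × List Γ | d q a γ z.1 z.2}.Finite) :
    {z : Option Q × Option T × Option Γ × Option Q × List (Option Γ) |
      PopMoves d fin z.1 z.2.1 z.2.2.1 z.2.2.2.1 z.2.2.2.2}.Finite := by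
  have h1 : (⋃ y : Q × Option T × Option Γ, (fun z : Q × List Γ => ((some y.1 : Option Q), y.2.1,
      y.2.2, some z.1, z.2.map some ++ if y.2.2 = none then [(none : Option Γ)] else [])) ''
      {z : Q × List Γ | d y.1 y.2.1 y.2.2 z.1 z.2}).Finite :=
    Set.finite_iUnion fun y => (hd _ _ _).image _
  have h2 : (Set.range fun y : Option Q × Option Γ =>
      (y.1, (none : Option T), y.2, (none : Option Q), ([] : List (Option Γ)))).Finite :=
    Set.finite_range _
  refine (h1.union h2).subset ?_
  rintro ⟨p, a, γ, p', η⟩ h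
  change PopMoves d fin p a γ p' η at h
  cases h with
  | @move q q' _ _ ζ h => exact .inl (Set.mem_iUnion.2 ⟨(q, a, γ), (q', ζ), h, rfl⟩)
  | finish h => exact .inr ⟨(_, _), rfl⟩
  | pop => exact .inr ⟨(_, _), rfl⟩

/-- Above the marker `none`, the top symbol is literally `s.head?`, also when `s` is empty. The
marker is popped exactly when a move sees the empty stack, and the `if` puts it back. -/
theorem exists_cons_of_map_some (s : List Γ) :
    ∃ t, s.map some ++ [none] = s.head? :: t ∧ ∀ ζ : List Γ, (ζ.map some ++
      if s.head? = none then [none] else []) ++ t = (ζ ++ s.tail).map some ++ [none] := by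
  cases s with
  | nil => exact ⟨[], by simp⟩
  | cons x s => exact ⟨s.map some ++ [none], by simp⟩

theorem popRun_none_iff {s : List (Option Γ)} {w : List T} :
    PopRun (PopMoves d fin) none none s w ↔ w = [] := by
  constructor
  · suffices ∀ p, PopRun (PopMoves d fin) none p s w → none = p → w = [] from
      fun h => this none h rfl
    intro p h hp
    induction h with
    | done => rfl
    | step he h ih =>
      cases he with
      | move => simp at hp
      | finish => simp at hp
      | pop => simpa using ih rfl
  · rintro rfl
    induction s with
    | nil => exact .done
    | cons x s ih => exact .step (a := none) (PopMoves.pop x) ih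

/-- The marker prevents the stack from being exhausted before `fin` has been checked; afterwards the
state `none` clears the stack without reading. Thus success of a pass becomes acceptance by empty
stack. -/
theorem popRun_popMoves_iff {q : Q} {s : List Γ} {w : List T} :
    PopRun (PopMoves d fin) none (some q) (s.map some ++ [none]) w ↔ PassRun d fin q s w := by
  constructor
  · intro h
    generalize hp : some q = p at h
    generalize ht : s.map some ++ [none] = t at h
    induction h generalizing q s with
    | done => simp at hp
    | @step p p' a x η t' w he h ih =>
      obtain ⟨t, hst, hs⟩ := exists_cons_of_map_some s
      obtain ⟨rfl, rfl⟩ := List.cons.inj (hst.symm.trans ht)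
      cases he with
      | @move q1 q' a γ ζ hd =>
        obtain rfl := Option.some.inj hp
        have h1 := ih rfl (hs _).symm
        cases a with
        | none => exact .eps hd h1
        | some σ => exact .read hd h1
      | finish hf =>
        obtain rfl := Option.some.inj hp
        obtain rfl := popRun_none_iff.1 h
        exact .finish hf
      | pop => simp at hp
  · intro h
    induction h with
    | @finish q s hf =>
      obtain ⟨t, ht, -⟩ := exists_cons_of_map_some s
      rw [ht]
      exact .step (a := none) (PopMoves.finish hf) (popRun_none_iff.2 rfl)
    | @read q q' σ s ζ u hd _ ih =>
      obtain ⟨t, ht, hs⟩ := exists_cons_of_map_some s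
      rw [ht]
      exact .step (a := some σ) (.move hd) (by rwa [hs])
    | @eps q q' s ζ u hd _ ih =>
      obtain ⟨t, ht, hs⟩ := exists_cons_of_map_some s
      rw [ht]
      exact .step (a := none) (.move hd) (by rwa [hs])

end PopMoves

theorem isContextFree_of_passRun {T : Type*} {Q Γ : Type} [Finite T] [Finite Q] [Finite Γ]
    {d : Q → Option T → Option Γ → Q → List Γ → Prop} {fin : Q → Option Γ → Prop}
    (hd : ∀ q a γ, {z : Q × List Γ | d q a γ z.1 z.2}.Finite) (q : Q) :
    Language.IsContextFree {w | PassRun d fin q [] w} :=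
  isContextFree_of_popRun (popMoves_finite (fin := fin) hd) (some q) none [none]
    fun _ => popRun_popMoves_iff.symm

/-! ### Poly-context-free languages -/

theorem Language.mem_iInf_iff {T : Type*} {ι : Sort*} {F : ι → Language T} {w : List T} :
    w ∈ ⨅ i, F i ↔ ∀ i, w ∈ F i :=
  Set.mem_iInter (s := F)

theorem isPolyContextFree_iInf {T ι : Type*} [Finite ι] [Nonempty ι] {F : ι → Language T}
    (hF : ∀ i, (F i).IsContextFree) : IsPolyContextFree (⨅ i, F i) := by
  obtain ⟨n, ⟨e⟩⟩ := Finite.exists_equiv_fin ι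
  obtain ⟨i⟩ := ‹Nonempty ι›
  cases n with
  | zero => exact (e i).elim0
  | succ m => exact ⟨m, F ∘ e.symm, fun i => hF _, (e.symm.iInf_comp (g := F)).symm⟩

namespace IsPolyContextFree

variable {T : Type*} {L L' : Language T}

theorem of_isContextFree (h : L.IsContextFree) : IsPolyContextFree L :=
  ⟨0, fun _ => L, fun _ => h, iInf_const.symm⟩

theorem inf (h : IsPolyContextFree L) (h' : IsPolyContextFree L') :
    IsPolyContextFree (L ⊓ L') := by
  obtain ⟨m, F, hF, rfl⟩ := h
  obtain ⟨m', F', hF', rfl⟩ := h'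
  have := isPolyContextFree_iInf (F := Sum.elim F F') (Sum.forall.2 ⟨hF, hF'⟩)
  rwa [iInf_sum] at this

/-- By distributivity the union of two intersections is the intersection of all pairwise unions, and
each of these is context-free. -/
theorem sup (h : IsPolyContextFree L) (h' : IsPolyContextFree L') :
    IsPolyContextFree (L ⊔ L') := by
  obtain ⟨m, F, hF, rfl⟩ := h
  obtain ⟨m', F', hF', rfl⟩ := h'
  have := isPolyContextFree_iInf (F := fun z : Fin (m + 1) × Fin (m' + 1) => F z.1 ⊔ F' z.2)
    fun z => (hF _).sup (hF' _)
  rwa [← iInf_sup_iInf] at this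

theorem iSup {ι : Type*} [Finite ι] {F : ι → Language T}
    (hF : ∀ i, IsPolyContextFree (F i)) : IsPolyContextFree (⨆ i, F i) :=
  SupClosed.iSup_mem (s := {L : Language T | IsPolyContextFree L}) (fun _ h _ h' => h.sup h')
    (of_isContextFree isContextFree_bot) hF

end IsPolyContextFree

theorem Language.mem_iSup_iff {T : Type*} {ι : Sort*} {F : ι → Language T} {w : List T} :
    w ∈ ⨆ i, F i ↔ ∃ i, w ∈ F i :=
  Set.mem_iUnion (s := F)

/-! ### Nondeterministic multipass languages are poly-context-free -/

namespace NondetMultipass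

variable {T Q Γ : Type*} {n : ℕ} (M : NondetMultipass T Q Γ n)

/-- The moves on pass `j`. -/
def moves (j : Fin (n + 1)) (q : Q) (a : Option T) (γ : Option Γ) (q' : Q) (ζ : List Γ) : Prop :=
  (q', ζ) ∈ M.δ j q a γ

theorem reaches_of_passRun {w u : List T} {j : Fin (n + 1)} {fin : Q → Option Γ → Prop} {q : Q}
    {s : List Γ} (h : PassRun (M.moves j) fin q s u) :
    ∃ q' s', fin q' s'.head? ∧
      Relation.ReflTransGen (M.Step w) (.running j q u s) (.running j q' [] s') := by
  induction h with
  | finish h => exact ⟨_, _, h, .refl⟩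
  | read hd _ ih =>
    obtain ⟨q', s', hf, h⟩ := ih
    exact ⟨q', s', hf, .head (.read hd) h⟩
  | eps hd _ ih =>
    obtain ⟨q', s', hf, h⟩ := ih
    exact ⟨q', s', hf, .head (.eps hd) h⟩

/-- A nonfinal pass can be left only through the end-marker, so an accepting run splits there. -/
theorem reaches_accept_castSucc_iff {w u : List T} {j : Fin n} {q : Q} {s : List Γ} :
    Relation.ReflTransGen (M.Step w) (.running j.castSucc q u s) (.halted .accept) ↔
      ∃ q', PassRun (M.moves j.castSucc) (fun q γ => q' ∈ M.δNext j q γ) q s u ∧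
        Relation.ReflTransGen (M.Step w) (.running j.succ q' w []) (.halted .accept) := by
  constructor
  · intro h
    generalize hc : MultipassConfig.running j.castSucc q u s = c at h
    induction h using Relation.ReflTransGen.head_induction_on generalizing q u s with
    | refl => simp at hc
    | head hs h ih =>
      cases hs with
      | read hd =>
        obtain ⟨rfl, rfl, rfl, rfl⟩ := MultipassConfig.running.inj hc
        obtain ⟨q', h1, h2⟩ := ih rfl
        exact ⟨q', .read hd h1, h2⟩
      | eps hd =>
        obtain ⟨rfl, rfl, rfl, rfl⟩ := MultipassConfig.running.inj hc
        obtain ⟨q', h1, h2⟩ := ih rfl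
        exact ⟨q', .eps hd h1, h2⟩
      | nextPass hd =>
        obtain ⟨hj, rfl, rfl, rfl⟩ := MultipassConfig.running.inj hc
        obtain rfl := Fin.castSucc_injective _ hj
        exact ⟨_, .finish hd, h⟩
      | halt => exact absurd (MultipassConfig.running.inj hc).1 (Fin.castSucc_ne_last j)
  · rintro ⟨q', h1, h2⟩
    obtain ⟨q1, s1, hf, h⟩ := M.reaches_of_passRun (w := w) h1
    exact h.trans (.head (.nextPass hf) h2)

theorem reaches_accept_last_iff {w u : List T} {q : Q} {s : List Γ} :
    Relation.ReflTransGen (M.Step w) (.running (Fin.last n) q u s) (.halted .accept) ↔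
      PassRun (M.moves (Fin.last n)) (fun q γ => M.δLast q γ = .accept) q s u := by
  constructor
  · intro h
    generalize hc : MultipassConfig.running (Fin.last n) q u s = c at h
    induction h using Relation.ReflTransGen.head_induction_on generalizing q u s with
    | refl => simp at hc
    | head hs h ih =>
      cases hs with
      | read hd =>
        obtain ⟨rfl, rfl, rfl, rfl⟩ := MultipassConfig.running.inj hc
        exact .read hd (ih rfl)
      | eps hd =>
        obtain ⟨rfl, rfl, rfl, rfl⟩ := MultipassConfig.running.inj hc
        exact .eps hd (ih rfl)
      | nextPass => exact absurd (MultipassConfig.running.inj hc).1.symm (Fin.castSucc_ne_last _)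
      | halt =>
        obtain ⟨-, rfl, rfl, rfl⟩ := MultipassConfig.running.inj hc
        refine .finish ?_
        rcases h.cases_head with h | ⟨_, h, -⟩
        · exact MultipassConfig.halted.inj h
        · cases h
  · intro h
    obtain ⟨q1, s1, hf, h⟩ := M.reaches_of_passRun (w := w) h
    exact h.tail (hf ▸ .halt)

theorem isPolyContextFree_from {T : Type*} {Q Γ : Type} [Finite T] [Finite Q] [Finite Γ] {n : ℕ}
    (M : NondetMultipass T Q Γ n) (j : Fin (n + 1)) (q : Q) :
    IsPolyContextFree
      {w | Relation.ReflTransGen (M.Step w) (.running j q w []) (.halted .accept)} := by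
  have hd (j q a γ) : {z : Q × List Γ | M.moves j q a γ z.1 z.2}.Finite :=
    (M.δ j q a γ).finite_toSet
  induction j using Fin.reverseInduction generalizing q with
  | last =>
    simp_rw [reaches_accept_last_iff]
    exact .of_isContextFree (isContextFree_of_passRun (hd _) q)
  | cast j ih =>
    -- Once the state `q'` handed to the next pass is fixed, the conditions on this pass and on the
    -- later ones are independent.
    have := IsPolyContextFree.iSup fun q' => (IsPolyContextFree.of_isContextFree
      (isContextFree_of_passRun (fin := fun q γ => q' ∈ M.δNext j q γ) (hd j.castSucc) q)).inf
      (ih q')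
    refine (congrArg IsPolyContextFree (Language.ext fun w => ?_)).mpr this
    rw [Language.mem_iSup_iff]
    exact M.reaches_accept_castSucc_iff

end NondetMultipass

theorem IsNondetMultipass.isPolyContextFree {T : Type*} [Finite T] {L : Language T}
    (h : IsNondetMultipass L) : IsPolyContextFree L := by
  obtain ⟨n, Q, Γ, _, _, M, rfl⟩ := h
  exact M.isPolyContextFree_from 0 M.start

/-! ### Poly-context-free languages are nondeterministic multipass languages -/

theorem PassRun.exists_fin {T Q Γ : Type*} {d : Q → Option T → Option Γ → Q → List Γ → Prop}
    {fin : Q → Option Γ → Prop} {q : Q} {s : List Γ} {u : List T} (h : PassRun d fin q s u) :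
    ∃ q γ, fin q γ := by
  induction h with
  | finish h => exact ⟨_, _, h⟩
  | read _ _ ih => exact ih
  | eps _ _ ih => exact ih

open Classical in
/-- The multipass automaton that makes independent passes with the moves `d j`, all started in the
state `q₀`, and that accepts if all of them succeed. -/
noncomputable def NondetMultipass.ofPasses {T Q Γ : Type*} {n : ℕ} (incl : T ↪ Γ)
    (d : Fin (n + 1) → Q → Option T → Option Γ → Q → List Γ → Prop)
    (hd : ∀ j q a γ, {z : Q × List Γ | d j q a γ z.1 z.2}.Finite)
    (heps : ∀ j q q' ζ, ¬ d j q none none q' ζ) (fin : Fin (n + 1) → Q → Option Γ → Prop) (q₀ : Q) :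
    NondetMultipass T Q Γ n where
  incl := incl
  start := q₀
  δ j q a γ := (hd j q a γ).toFinset
  eps_empty j q := by
    ext z
    simp [heps]
  δNext j q γ := {q' | q' = q₀ ∧ fin j.castSucc q γ}
  δLast q γ := if fin (Fin.last n) q γ then .accept else .noDecision

theorem NondetMultipass.mem_language_ofPasses {T Q Γ : Type*} {n : ℕ} (incl : T ↪ Γ)
    (d : Fin (n + 1) → Q → Option T → Option Γ → Q → List Γ → Prop)
    (hd : ∀ j q a γ, {z : Q × List Γ | d j q a γ z.1 z.2}.Finite)
    (heps : ∀ j q q' ζ, ¬ d j q none none q' ζ) (fin : Fin (n + 1) → Q → Option Γ → Prop) (q₀ : Q)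
    (w : List T) :
    w ∈ (ofPasses incl d hd heps fin q₀).language ↔ ∀ j, PassRun (d j) (fin j) q₀ [] w := by
  set M := ofPasses incl d hd heps fin q₀ with hM
  have hmoves (j) : M.moves j = d j := by
    funext q a γ q' ζ
    simp [moves, hM, ofPasses]
  suffices ∀ j, Relation.ReflTransGen (M.Step w) (.running j q₀ w []) (.halted .accept) ↔
      ∀ i, j ≤ i → PassRun (d i) (fin i) q₀ [] w from
    (this 0).trans ⟨fun h i => h i (Fin.zero_le i), fun h i _ => h i⟩
  intro j
  induction j using Fin.reverseInduction with
  | last =>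
    rw [reaches_accept_last_iff, hmoves]
    have : (fun q γ => M.δLast q γ = .accept) = fin (Fin.last n) := by
      funext q γ
      simp [hM, ofPasses]
    rw [this]
    refine ⟨fun h i hi => ?_, fun h => h _ le_rfl⟩
    obtain rfl := Fin.last_le_iff.1 hi
    exact h
  | cast j ih =>
    rw [reaches_accept_castSucc_iff, hmoves]
    constructor
    · rintro ⟨q', h1, h2⟩ i hi
      -- Some configuration satisfies the final condition of the pass, which contains `q' = q₀`.
      obtain ⟨_, _, rfl, -⟩ := h1.exists_fin
      rcases hi.eq_or_lt with rfl | hi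
      · exact h1.mono fun q γ h => h.2
      · exact ih.1 h2 i (Fin.castSucc_lt_iff_succ_le.1 hi)
    · intro h
      exact ⟨q₀, (h _ le_rfl).mono fun q γ h => ⟨rfl, h⟩,
        ih.2 fun i hi => h i (Fin.castSucc_lt_succ.le.trans hi)⟩

/-- The moves of a top-down parser for the rules `R` with initial nonterminal `S`. A stack symbol
`γ` stands for the symbol `dec γ` of the grammar. The parser starts in the state `none` with the
empty stack; when it reads the first letter `σ` it puts `S` on the stack and enters the state
`some (some (c σ))`, which it keeps until `σ` is matched; its state is `some none` from then on. -/
inductive ParseMoves {T N Γ K : Type*} (R : Set (ContextFreeRule T N)) (S : N)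
    (dec : Γ → Symbol T N) (c : T → K) :
    Option (Option K) → Option T → Option Γ → Option (Option K) → List Γ → Prop
  | start {σ : T} {ζ : List Γ} (h : ζ.map dec = [.nonterminal S]) :
      ParseMoves R S dec c none (some σ) none (some (some (c σ))) ζ
  | expand {p : Option K} {γ : Γ} {ζ : List Γ} {r : ContextFreeRule T N} (hr : r ∈ R)
      (hγ : dec γ = .nonterminal r.input) (h : ζ.map dec = r.output) :
      ParseMoves R S dec c (some p) none (some γ) (some p) ζ
  | shift {σ : T} {γ : Γ} (hγ : dec γ = .terminal σ) :
      ParseMoves R S dec c (some none) (some σ) (some γ) (some none) []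
  | matched {σ : T} {γ : Γ} (hγ : dec γ = .terminal σ) :
      ParseMoves R S dec c (some (some (c σ))) none (some γ) (some none) []

section ParseMoves

variable {T N Γ K : Type*} {R : Set (ContextFreeRule T N)} {S : N} {dec : Γ → Symbol T N}
  {c : T → K}

theorem parseMoves_finite [Finite Γ] [Finite K] (hR : R.Finite) (q : Option (Option K))
    (a : Option T) (γ : Option Γ) :
    {z : Option (Option K) × List Γ | ParseMoves R S dec c q a γ z.1 z.2}.Finite := by
  -- The possible decodings of a pushed word. Each has finitely many codes, since decoding preserves
  -- length and `Γ` is finite.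
  have hl : (insert [] (insert [.nonterminal S] (ContextFreeRule.output '' R))).Finite :=
    ((hR.image _).insert _).insert _
  have hζ := hl.biUnion (t := fun l => {ζ : List Γ | ζ.map dec = l}) fun l _ =>
    (List.finite_length_eq Γ l.length).subset fun ζ (h : ζ.map dec = l) => by simp [← h]
  refine (Set.finite_univ.prod hζ).subset ?_
  rintro ⟨q', ζ⟩ h
  change ParseMoves R S dec c q a γ q' ζ at h
  refine ⟨trivial, Set.mem_iUnion₂.2 ⟨ζ.map dec, ?_, rfl⟩⟩
  cases h with
  | start h => exact .inr (.inl h)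
  | expand hr _ h => exact .inr (.inr ⟨_, hr, h.symm⟩)
  | shift => exact .inl rfl
  | matched => exact .inl rfl

/-- The parser is successful when its stack is empty and no letter is left to be matched, or, if
`E` holds, at the very beginning. -/
def ParseFin (E : Prop) (q : Option (Option K)) (γ : Option Γ) : Prop :=
  γ = none ∧ (q = some none ∨ q = none ∧ E)

/-- The letter held in the state has been read but not yet matched, so it is put back in front of
the unread input. -/
theorem yields_of_passRun_parseMoves (hc : Function.Injective c) {E : Prop} {p : Option T}
    {s : List Γ} {u : List T}
    (h : PassRun (ParseMoves R S dec c) (ParseFin E) (some (p.map c)) s u) :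
    Yields R (s.map dec) (p.toList ++ u) := by
  generalize hq : some (p.map c) = q at h
  induction h generalizing p with
  | @finish q s h =>
    subst hq
    obtain ⟨hs, h⟩ := h
    obtain rfl : s = [] := by simpa using hs
    obtain rfl : p = none := by simpa using h
    exact .nil
  | @read q q' σ s ζ u hd h ih =>
    generalize ha : (some σ : Option T) = a at hd
    generalize hγ : s.head? = γ' at hd
    cases hd with
    | start => simp at hq
    | expand => simp at ha
    | shift hx =>
      obtain ⟨s, rfl⟩ := List.head?_eq_some_iff.1 hγ
      obtain rfl := Option.some.inj ha
      obtain rfl : p = none := by simpa using hq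
      have := ih (p := none) rfl
      rw [List.map_cons, hx]
      exact .terminal this
    | matched => simp at ha
  | @eps q q' s ζ u hd h ih =>
    generalize ha : (none : Option T) = a at hd
    generalize hγ : s.head? = γ' at hd
    cases hd with
    | start => simp at hq
    | expand hr hx hζ =>
      obtain ⟨s, rfl⟩ := List.head?_eq_some_iff.1 hγ
      have := ih hq
      rw [List.map_cons, hx]
      exact .nonterminal hr (by simpa [hζ] using this)
    | shift => simp at ha
    | @matched σ _ hx =>
      obtain ⟨s, rfl⟩ := List.head?_eq_some_iff.1 hγ
      obtain rfl : p = some σ := by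
        cases p with
        | none => simp at hq
        | some τ => simpa [hc.eq_iff] using hq
      have := ih (p := none) rfl
      rw [List.map_cons, hx]
      exact .terminal this

theorem passRun_parseMoves_of_yields
    (hdec : ∀ r ∈ R, ∀ x ∈ r.output, x ∈ Set.range dec) {E : Prop} {p : Option T}
    {s : List Γ} {u : List T} (h : Yields R (s.map dec) (p.toList ++ u)) :
    PassRun (ParseMoves R S dec c) (ParseFin E) (some (p.map c)) s u := by
  generalize hα : s.map dec = α at h
  generalize hw : p.toList ++ u = w at h
  induction h generalizing p s u with
  | nil =>
    obtain rfl : s = [] := by simpa using hα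
    obtain ⟨hp, rfl⟩ := List.append_eq_nil_iff.1 hw
    obtain rfl : p = none := by simpa using hp
    exact .finish ⟨rfl, .inl rfl⟩
  | terminal _ ih =>
    obtain ⟨γ, s, rfl, hγ, rfl⟩ := List.map_eq_cons_iff.1 hα
    cases p with
    | none =>
      subst hw
      exact .read (.shift hγ) (ih (p := none) rfl rfl)
    | some τ =>
      obtain ⟨rfl, rfl⟩ := List.cons.inj hw
      exact .eps (.matched hγ) (ih (p := none) rfl rfl)
  | @nonterminal r _ _ hr _ ih =>
    obtain ⟨γ, s, rfl, hγ, rfl⟩ := List.map_eq_cons_iff.1 hα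
    obtain ⟨ζ, hζ⟩ : r.output ∈ Set.range (List.map dec) := by
      rw [Set.range_list_map]
      exact hdec r hr
    exact .eps (.expand hr hγ hζ) (ih (by simp [hζ]) hw)

/-- On the empty stack no `ε`-move is allowed, so the initial nonterminal can be pushed only while
reading the first letter, which is then kept in the state. The empty word is therefore settled
separately by the condition `E` of `ParseFin`. -/
theorem passRun_parseMoves_iff (hc : Function.Injective c)
    (hdec : ∀ r ∈ R, ∀ x ∈ r.output, x ∈ Set.range dec) (hS : .nonterminal S ∈ Set.range dec)
    (w : List T) :
    PassRun (ParseMoves R S dec c) (ParseFin (Yields R [.nonterminal S] [])) none [] w ↔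
      Yields R [.nonterminal S] w := by
  constructor
  · intro h
    cases h with
    | finish h => simpa using h.2
    | read hd h =>
      cases hd with
      | @start _ ζ hζ =>
        have := yields_of_passRun_parseMoves hc (p := some _) h
        simpa [hζ] using this
    | eps hd => cases hd
  · intro h
    cases w with
    | nil => exact .finish ⟨rfl, .inr ⟨rfl, h⟩⟩
    | cons σ w =>
      obtain ⟨γ, hγ⟩ := hS
      refine .read (ζ := [γ]) (.start (by simp [hγ])) ?_
      exact passRun_parseMoves_of_yields hdec (p := some σ)
        (by simpa [hγ] using h)

end ParseMoves

/-- The types of nonterminals may be infinite, but only finitely many symbols occur in rule outputs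
or as initial symbols. A disjoint union of enumerations of them, with a copy of `T`, serves all
grammars at once. -/
theorem ContextFreeGrammar.exists_stack_alphabet {T : Type*} [Finite T] {ι : Type} [Finite ι]
    (g : ι → ContextFreeGrammar T) :
    ∃ (Γ : Type) (_ : Finite Γ) (_ : T ↪ Γ) (dec : ∀ i, Γ → Symbol T (g i).NT),
      ∀ i, .nonterminal (g i).initial ∈ Set.range (dec i) ∧
        ∀ r ∈ (g i).rules, ∀ x ∈ r.output, x ∈ Set.range (dec i) := by
  have hU (i) : (insert (Symbol.nonterminal (g i).initial)
      (⋃ r ∈ ((g i).rules : Set (ContextFreeRule T (g i).NT)), {x | x ∈ r.output})).Finite :=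
    ((g i).rules.finite_toSet.biUnion fun r _ => List.finite_toSet r.output).insert _
  choose K f _ hf using fun i => (hU i).fin_param
  obtain ⟨m, ⟨e⟩⟩ := Finite.exists_equiv_fin T
  have hinj (i) : Function.Injective fun k => (Sum.inr ⟨i, k⟩ : Fin m ⊕ Σ i, Fin (K i)) :=
    fun k l h => by simpa using h
  -- Symbols not belonging to grammar `i` decode to a default. This is harmless, as decoding need
  -- only be surjective onto the symbols in use, not injective.
  have key (i) : ∀ x ∈ Set.range (f i), x ∈ Set.range (Function.extend
      (fun k => (Sum.inr ⟨i, k⟩ : Fin m ⊕ Σ i, Fin (K i))) (f i)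
      fun _ => .nonterminal (g i).initial) := by
    rintro _ ⟨k, rfl⟩
    exact ⟨_, (hinj i).extend_apply _ _ k⟩
  refine ⟨Fin m ⊕ Σ i, Fin (K i), inferInstance, e.toEmbedding.trans Function.Embedding.inl,
    fun i => Function.extend (fun k => Sum.inr ⟨i, k⟩) (f i) fun _ => .nonterminal (g i).initial,
    fun i => ⟨key i _ (hf i ▸ .inl rfl), fun r hr x hx => key i _ ?_⟩⟩
  rw [hf]
  exact .inr (Set.mem_iUnion₂.2 ⟨r, hr, hx⟩)

theorem IsPolyContextFree.isNondetMultipass {T : Type*} [Finite T] {L : Language T}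
    (h : IsPolyContextFree L) : IsNondetMultipass L := by
  obtain ⟨n, F, hF, rfl⟩ := h
  choose g hg using hF
  obtain rfl : (fun i => (g i).language) = F := funext hg
  obtain ⟨Γ, _, incl, dec, hdec⟩ := ContextFreeGrammar.exists_stack_alphabet g
  obtain ⟨m, ⟨e⟩⟩ := Finite.exists_equiv_fin T
  refine ⟨n, Option (Option (Fin m)), Γ, inferInstance, inferInstance, .ofPasses incl
    (fun j => ParseMoves ((g j).rules : Set (ContextFreeRule T (g j).NT)) (g j).initial (dec j) e)
    (fun j => parseMoves_finite (g j).rules.finite_toSet) (fun j q q' ζ h => by cases h)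
    (fun j => ParseFin (Yields ((g j).rules : Set (ContextFreeRule T (g j).NT)) [.nonterminal (g j).initial] [])) none, ?_⟩
  ext w
  rw [NondetMultipass.mem_language_ofPasses, Language.mem_iInf_iff]
  refine forall_congr' fun j => ?_
  rw [passRun_parseMoves_iff e.injective (hdec j).2 (hdec j).1,
    ContextFreeGrammar.mem_language_iff_yields]

/-! ### Deterministic multipass languages are Boolean combinations -/

namespace DetMultipass

variable {T Q Γ : Type*} {n : ℕ} (M : DetMultipass T Q Γ n)

/-- The moves on pass `j`. -/
def moves (j : Fin (n + 1)) (q : Q) (a : Option T) (γ : Option Γ) (q' : Q) (ζ : List Γ) : Prop :=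
  M.δ j q a γ = some (q', ζ)

theorem reaches_of_passRun {w u : List T} {j : Fin (n + 1)} {fin : Q → Option Γ → Prop} {q : Q}
    {s : List Γ} (h : PassRun (M.moves j) fin q s u) :
    ∃ q' s', fin q' s'.head? ∧
      Relation.ReflTransGen (M.Step w) (.running j q u s) (.running j q' [] s') := by
  induction h with
  | finish h => exact ⟨_, _, h, .refl⟩
  | read hd _ ih =>
    obtain ⟨q', s', hf, h⟩ := ih
    exact ⟨q', s', hf, .head (.read hd) h⟩
  | eps hd _ ih =>
    obtain ⟨q', s', hf, h⟩ := ih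
    exact ⟨q', s', hf, .head (.eps hd) h⟩

theorem reaches_accept_castSucc_iff {w u : List T} {j : Fin n} {q : Q} {s : List Γ} :
    Relation.ReflTransGen (M.Step w) (.running j.castSucc q u s) (.halted .accept) ↔
      ∃ q', PassRun (M.moves j.castSucc)
          (fun q γ => M.δ j.castSucc q none γ = none ∧ M.δNext j q γ = q') q s u ∧
        Relation.ReflTransGen (M.Step w) (.running j.succ q' w []) (.halted .accept) := by
  constructor
  · intro h
    generalize hc : MultipassConfig.running j.castSucc q u s = c at h
    induction h using Relation.ReflTransGen.head_induction_on generalizing q u s with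
    | refl => simp at hc
    | head hs h ih =>
      cases hs with
      | read hd =>
        obtain ⟨rfl, rfl, rfl, rfl⟩ := MultipassConfig.running.inj hc
        obtain ⟨q', h1, h2⟩ := ih rfl
        exact ⟨q', .read hd h1, h2⟩
      | eps hd =>
        obtain ⟨rfl, rfl, rfl, rfl⟩ := MultipassConfig.running.inj hc
        obtain ⟨q', h1, h2⟩ := ih rfl
        exact ⟨q', .eps hd h1, h2⟩
      | nextPass hd =>
        obtain ⟨hj, rfl, rfl, rfl⟩ := MultipassConfig.running.inj hc
        obtain rfl := Fin.castSucc_injective _ hj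
        exact ⟨_, .finish ⟨hd, rfl⟩, h⟩
      | halt => exact absurd (MultipassConfig.running.inj hc).1 (Fin.castSucc_ne_last j)
  · rintro ⟨q', h1, h2⟩
    obtain ⟨q1, s1, ⟨hn, rfl⟩, h⟩ := M.reaches_of_passRun (w := w) h1
    exact h.trans (.head (.nextPass hn) h2)

theorem reaches_accept_last_iff {w u : List T} {q : Q} {s : List Γ} :
    Relation.ReflTransGen (M.Step w) (.running (Fin.last n) q u s) (.halted .accept) ↔
      PassRun (M.moves (Fin.last n))
        (fun q γ => M.δ (Fin.last n) q none γ = none ∧ M.δLast q γ = .accept) q s u := by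
  constructor
  · intro h
    generalize hc : MultipassConfig.running (Fin.last n) q u s = c at h
    induction h using Relation.ReflTransGen.head_induction_on generalizing q u s with
    | refl => simp at hc
    | head hs h ih =>
      cases hs with
      | read hd =>
        obtain ⟨rfl, rfl, rfl, rfl⟩ := MultipassConfig.running.inj hc
        exact .read hd (ih rfl)
      | eps hd =>
        obtain ⟨rfl, rfl, rfl, rfl⟩ := MultipassConfig.running.inj hc
        exact .eps hd (ih rfl)
      | nextPass => exact absurd (MultipassConfig.running.inj hc).1.symm (Fin.castSucc_ne_last _)
      | halt hd =>
        obtain ⟨-, rfl, rfl, rfl⟩ := MultipassConfig.running.inj hc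
        refine .finish ⟨hd, ?_⟩
        rcases h.cases_head with h | ⟨_, h, -⟩
        · exact MultipassConfig.halted.inj h
        · cases h
  · intro h
    obtain ⟨q1, s1, ⟨hn, hf⟩, h⟩ := M.reaches_of_passRun (w := w) h
    exact h.tail (hf ▸ .halt hn)

/-- The effect of a move `(q, ζ)` on a machine that keeps the top of the stack in its state, when
the symbol below it is `γ`. The bottom marker `none` is never removed. -/
def pushKeepingTop (q : Q) : List Γ → Option Γ → (Q × Option Γ) × List (Option Γ)
  | [], γ => ((q, γ), if γ = none then [none] else [])
  | x :: ζ, γ => ((q, some x), ζ.map some ++ [γ])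

/-- The pushdown automaton that carries out pass `j` from the state `q`. It keeps the top of the
stack in its state. -/
def passPushdown (j : Fin (n + 1)) (q : Q) (fin : Q → Option Γ → Prop) :
    DetPushdown T (Q × Option Γ) (Option Γ) where
  δ p a γ := (M.δ j p.1 a p.2).map fun z => pushKeepingTop z.1 z.2 γ
  start := (q, none)
  bottom := none
  final := {p | fin p.1 p.2}
  deterministic p γ h σ := by
    rw [Option.isSome_map] at h
    rw [M.deterministic j _ _ h σ, Option.map_none]

theorem exists_cons_of_tail (s : List Γ) :
    ∃ γ t, s.tail.map some ++ [none] = γ :: t ∧ ∀ (q : Q) (ζ : List Γ),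
      (pushKeepingTop q ζ γ).1 = (q, (ζ ++ s.tail).head?) ∧
      (pushKeepingTop q ζ γ).2 ++ t = (ζ ++ s.tail).tail.map some ++ [none] := by
  rcases s.tail with _ | ⟨x, s⟩
  · refine ⟨none, [], rfl, fun q ζ => ?_⟩
    cases ζ <;> simp [pushKeepingTop]
  · refine ⟨some x, s.map some ++ [none], rfl, fun q ζ => ?_⟩
    cases ζ <;> simp [pushKeepingTop]

/-- Acceptance by final state sees only the state, while `fin` also looks at the top of the stack,
and a pass may move on the empty stack. Hence the top is held in the state and only the tail is
stacked, above a permanent marker. -/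
theorem passPushdown_accepts_iff {j : Fin (n + 1)} {q₀ : Q} {fin : Q → Option Γ → Prop} {q : Q}
    {s : List Γ} {u : List T} :
    (∃ p ∈ (M.passPushdown j q₀ fin).final, ∃ t,
      Relation.ReflTransGen (M.passPushdown j q₀ fin).Step
        ((q, s.head?), u, s.tail.map some ++ [none]) (p, [], t)) ↔
      PassRun (M.moves j) fin q s u := by
  constructor
  · rintro ⟨p, hp, t, h⟩
    generalize hc : ((q, s.head?), u, s.tail.map some ++ [(none : Option Γ)]) = c at h
    induction h using Relation.ReflTransGen.head_induction_on generalizing q u s with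
    | refl =>
      obtain ⟨rfl, rfl, -⟩ : (q, s.head?) = p ∧ u = [] ∧ _ := by simpa using hc
      exact .finish hp
    | head hs h ih =>
      obtain ⟨γ, t, hst, hpush⟩ := exists_cons_of_tail (Q := Q) s
      rw [hst] at hc
      cases hs with
      | read hd =>
        obtain ⟨rfl, rfl, rfl, rfl⟩ : (q, s.head?) = _ ∧ u = _ ∧ γ = _ ∧ t = _ := by
          simpa using hc
        obtain ⟨⟨q', ζ⟩, hδ, hz⟩ := Option.map_eq_some_iff.1 hd
        obtain ⟨h1, h2⟩ := hpush q' ζ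
        rw [hz] at h1 h2
        exact .read hδ (ih (by rw [← h1, ← h2]))
      | eps hd =>
        obtain ⟨rfl, rfl, rfl, rfl⟩ : (q, s.head?) = _ ∧ u = _ ∧ γ = _ ∧ t = _ := by
          simpa using hc
        obtain ⟨⟨q', ζ⟩, hδ, hz⟩ := Option.map_eq_some_iff.1 hd
        obtain ⟨h1, h2⟩ := hpush q' ζ
        rw [hz] at h1 h2
        exact .eps hδ (ih (by rw [← h1, ← h2]))
  · intro h
    induction h with
    | finish h => exact ⟨_, h, _, .refl⟩
    | @read q q' σ s ζ u hd _ ih =>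
      obtain ⟨p, hp, t', h⟩ := ih
      obtain ⟨γ, t, hst, hpush⟩ := exists_cons_of_tail (Q := Q) s
      obtain ⟨h1, h2⟩ := hpush q' ζ
      refine ⟨p, hp, t', ?_⟩
      rw [hst]
      rw [← h1, ← h2] at h
      exact .head (.read (Option.map_eq_some_iff.2 ⟨(q', ζ), hd, rfl⟩)) h
    | @eps q q' s ζ u hd _ ih =>
      obtain ⟨p, hp, t', h⟩ := ih
      obtain ⟨γ, t, hst, hpush⟩ := exists_cons_of_tail (Q := Q) s
      obtain ⟨h1, h2⟩ := hpush q' ζ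
      refine ⟨p, hp, t', ?_⟩
      rw [hst]
      rw [← h1, ← h2] at h
      exact .head (.eps (Option.map_eq_some_iff.2 ⟨(q', ζ), hd, rfl⟩)) h

theorem isDetContextFree_pass {T : Type*} {Q Γ : Type} [Finite Q] [Finite Γ] {n : ℕ}
    (M : DetMultipass T Q Γ n) (j : Fin (n + 1)) (fin : Q → Option Γ → Prop) (q : Q) :
    IsDetContextFree {w | PassRun (M.moves j) fin q [] w} :=
  ⟨_, _, inferInstance, inferInstance, M.passPushdown j q fin,
    Language.ext fun _ => M.passPushdown_accepts_iff (s := [])⟩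

theorem mem_closure_from {T : Type*} {Q Γ : Type} [Finite Q] [Finite Γ] {n : ℕ}
    (M : DetMultipass T Q Γ n) (j : Fin (n + 1)) (q : Q) :
    ({w | Relation.ReflTransGen (M.Step w) (.running j q w []) (.halted .accept)} : Language T) ∈
      BooleanSubalgebra.closure {L : Language T | IsDetContextFree L} := by
  induction j using Fin.reverseInduction generalizing q with
  | last =>
    simp_rw [reaches_accept_last_iff]
    exact BooleanSubalgebra.subset_closure (M.isDetContextFree_pass _ _ q)
  | cast j ih =>
    let F (q' : Q) : Language T := {w | PassRun (M.moves j.castSucc)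
      (fun q γ => M.δ j.castSucc q none γ = none ∧ M.δNext j q γ = q') q [] w}
    let G (q' : Q) : Language T :=
      {w | Relation.ReflTransGen (M.Step w) (.running j.succ q' w []) (.halted .accept)}
    have hF (q') : F q' ∈ BooleanSubalgebra.closure {L : Language T | IsDetContextFree L} :=
      BooleanSubalgebra.subset_closure (M.isDetContextFree_pass _ _ q)
    have := BooleanSubalgebra.iSup_mem fun q' => BooleanSubalgebra.inf_mem (hF q') (ih q')
    refine (congrArg (· ∈ BooleanSubalgebra.closure {L : Language T | IsDetContextFree L})
      (Language.ext fun w => ?_)).mpr this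
    exact M.reaches_accept_castSucc_iff.trans
      (Language.mem_iSup_iff (F := fun q' => F q' ⊓ G q')).symm

end DetMultipass

theorem IsDetMultipass.mem_closure {T : Type*} {L : Language T} (h : IsDetMultipass L) :
    L ∈ BooleanSubalgebra.closure {L : Language T | IsDetContextFree L} := by
  obtain ⟨n, Q, Γ, _, _, M, rfl⟩ := h
  exact M.mem_closure_from 0 M.start

/-! ### Deterministic context-free languages are decided in one pass -/

namespace DetPushdown

variable {T Q Γ : Type*} (M : DetPushdown T Q Γ)

/-- The moves of a pushdown automaton; there are none when the stack is empty. -/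
def moves (q : Q) (a : Option T) (γ : Option Γ) (q' : Q) (ζ : List Γ) : Prop :=
  γ.bind (M.δ q a) = some (q', ζ)

/-- Acceptance by final state from an arbitrary configuration. -/
def Accepts (q : Q) (s : List Γ) (u : List T) : Prop :=
  PassRun M.moves (fun q _ => q ∈ M.final) q s u

theorem accepts_iff_reaches {q : Q} {s : List Γ} {u : List T} :
    (∃ p ∈ M.final, ∃ t, Relation.ReflTransGen M.Step (q, u, s) (p, [], t)) ↔ M.Accepts q s u := by
  constructor
  · rintro ⟨p, hp, t, h⟩
    generalize hc : (q, u, s) = c at h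
    induction h using Relation.ReflTransGen.head_induction_on generalizing q u s with
    | refl =>
      obtain ⟨rfl, rfl, rfl⟩ : q = p ∧ u = [] ∧ s = t := by simpa using hc
      exact .finish hp
    | head hs h ih =>
      cases hs with
      | read hd =>
        obtain ⟨rfl, rfl, rfl⟩ : q = _ ∧ u = _ ∧ s = _ := by simpa using hc
        exact .read hd (ih rfl)
      | eps hd =>
        obtain ⟨rfl, rfl, rfl⟩ : q = _ ∧ u = _ ∧ s = _ := by simpa using hc
        exact .eps hd (ih rfl)
  · intro h
    induction h with
    | finish h => exact ⟨_, h, _, .refl⟩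
    | @read q q' σ s ζ u hd _ ih =>
      obtain ⟨p, hp, t', h⟩ := ih
      cases s with
      | nil => cases hd
      | cons γ s => exact ⟨p, hp, t', .head (.read hd) h⟩
    | @eps q q' s ζ u hd _ ih =>
      obtain ⟨p, hp, t', h⟩ := ih
      cases s with
      | nil => cases hd
      | cons γ s => exact ⟨p, hp, t', .head (.eps hd) h⟩

theorem mem_language_iff_accepts {w : List T} :
    w ∈ M.language ↔ M.Accepts M.start [M.bottom] w :=
  M.accepts_iff_reaches

variable {M}

theorem accepts_empty_iff {q : Q} {u : List T} : M.Accepts q [] u ↔ u = [] ∧ q ∈ M.final := by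
  constructor
  · intro h
    cases h with
    | finish h => exact ⟨rfl, h⟩
    | read hd => cases hd
    | eps hd => cases hd
  · rintro ⟨rfl, h⟩
    exact .finish h

theorem accepts_iff_of_eps {q q' : Q} {γ : Γ} {s ζ : List Γ} (h : M.δ q none γ = some (q', ζ))
    {u : List T} : M.Accepts q (γ :: s) u ↔ u = [] ∧ q ∈ M.final ∨ M.Accepts q' (ζ ++ s) u := by
  constructor
  · intro h'
    cases h' with
    | finish h => exact .inl ⟨rfl, h⟩
    | @read _ _ σ _ _ _ hd =>
      have := M.deterministic q γ (by simp [h]) σ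
      cases this.symm.trans hd
    | eps hd h' =>
      cases h.symm.trans hd
      exact .inr h'
  · rintro (⟨rfl, hq⟩ | h')
    · exact .finish hq
    · exact .eps h h'

theorem accepts_nil_iff_of_no_eps {q : Q} {γ : Γ} {s : List Γ} (h : M.δ q none γ = none) :
    M.Accepts q (γ :: s) [] ↔ q ∈ M.final := by
  constructor
  · intro h'
    cases h' with
    | finish h => exact h
    | eps hd => cases h.symm.trans hd
  · exact fun hq => .finish hq

theorem accepts_cons_iff_of_no_eps {q : Q} {γ : Γ} {s : List Γ} (h : M.δ q none γ = none) {σ : T}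
    {u : List T} : M.Accepts q (γ :: s) (σ :: u) ↔
      ∃ z, M.δ q (some σ) γ = some z ∧ M.Accepts z.1 (z.2 ++ s) u := by
  constructor
  · intro h'
    cases h' with
    | read hd h' => exact ⟨_, hd, h'⟩
    | eps hd => cases h.symm.trans hd
  · rintro ⟨z, hz, h'⟩
    exact .read hz h'

variable (M) in
/-- An `ε`-move; the input does not matter. -/
def EpsStep (c c' : Q × List Γ) : Prop :=
  ∃ γ s ζ, c.2 = γ :: s ∧ M.δ c.1 none γ = some (c'.1, ζ) ∧ c'.2 = ζ ++ s

variable (M) in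
/-- The sequence of `ε`-moves from a configuration is finite. -/
def EpsTerminates (c : Q × List Γ) : Prop :=
  Acc (fun c' c => M.EpsStep c c') c

theorem epsTerminates_nil (q : Q) : M.EpsTerminates (q, []) :=
  .intro _ fun _ ⟨_, _, _, h, _⟩ => by cases h

theorem epsTerminates_of_no_eps {q : Q} {γ : Γ} {s : List Γ} (h : M.δ q none γ = none) :
    M.EpsTerminates (q, γ :: s) := by
  refine .intro _ ?_
  rintro c ⟨γ', s', ζ, hs, hd, -⟩
  cases hs
  cases h.symm.trans hd

theorem epsTerminates_of_eps {q q' : Q} {γ : Γ} {s ζ : List Γ} (h : M.δ q none γ = some (q', ζ))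
    (h' : M.EpsTerminates (q', ζ ++ s)) : M.EpsTerminates (q, γ :: s) := by
  refine .intro _ ?_
  rintro ⟨q₁, s₁⟩ ⟨γ', s', ζ', hs, hd, hs₁⟩
  cases hs
  cases h.symm.trans hd
  obtain rfl : s₁ = ζ ++ s := hs₁
  exact h'

theorem Accepts.append {q : Q} {t : List Γ} {u : List T} (h : M.Accepts q t u) (s : List Γ) :
    M.Accepts q (t ++ s) u := by
  unfold Accepts at h
  induction h with
  | finish h => exact .finish h
  | @read q q' σ t ζ u hd _ ih =>
    cases t with
    | nil => cases hd
    | cons γ t => exact .read hd (by simpa [Accepts] using ih)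
  | @eps q q' t ζ u hd _ ih =>
    cases t with
    | nil => cases hd
    | cons γ t => exact .eps hd (by simpa [Accepts] using ih)

/-- Endless `ε`-moves on `t` alone can neither use up `t` nor, by determinism, stop for a letter. So
`s` is never touched and the input must be empty. -/
theorem Accepts.of_not_epsTerminates {q : Q} {t s : List Γ} {u : List T}
    (h : M.Accepts q (t ++ s) u) (ht : ¬ M.EpsTerminates (q, t)) :
    u = [] ∧ M.Accepts q t [] := by
  generalize hs : t ++ s = s' at h
  unfold Accepts at h
  induction h generalizing t with
  | finish h => exact ⟨rfl, .finish h⟩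
  | @read q q' σ s' ζ u hd h ih =>
    cases t with
    | nil => exact absurd (epsTerminates_nil q) ht
    | cons γ t =>
      subst hs
      refine absurd (epsTerminates_of_no_eps ?_) ht
      by_contra hne
      have := M.deterministic q γ (Option.isSome_iff_ne_none.2 hne) σ
      cases this.symm.trans hd
  | @eps q q' s' ζ u hd h ih =>
    cases t with
    | nil => exact absurd (epsTerminates_nil q) ht
    | cons γ t =>
      subst hs
      obtain ⟨rfl, h'⟩ := ih (t := ζ ++ t) (fun h => ht (epsTerminates_of_eps hd h)) (by simp)
      exact ⟨rfl, .eps hd h'⟩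

/-- Before the first letter is read, the automaton either cannot read it, or the configuration
reached by reading it is determined. -/
theorem exists_read_letter (σ : T) (c : Q × List Γ) :
    (∃ c' : Q × List Γ, ∀ u, M.Accepts c.1 c.2 (σ :: u) ↔ M.Accepts c'.1 c'.2 u) ∨
      ∀ u, ¬ M.Accepts c.1 c.2 (σ :: u) := by
  -- A terminating sequence of `ε`-moves is followed to its end, where the letter is read or the
  -- machine is stuck; an endless one never reads the letter.
  by_cases hc : M.EpsTerminates c
  · induction hc with
    | intro c _ ih =>
      obtain ⟨q, s⟩ := c
      cases s with
      | nil => exact .inr fun u h => by simpa using (accepts_empty_iff.1 h).1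
      | cons γ s =>
        cases h : M.δ q none γ with
        | none =>
          simp only [accepts_cons_iff_of_no_eps h]
          cases M.δ q (some σ) γ with
          | none => exact .inr (by simp)
          | some z => exact .inl ⟨(z.1, z.2 ++ s), by simp⟩
        | some z =>
          have := ih (z.1, z.2 ++ s) ⟨γ, s, z.2, rfl, h, rfl⟩
          simpa [accepts_iff_of_eps h] using this
  · refine .inr fun u h => ?_
    have := (Accepts.of_not_epsTerminates (t := c.2) (s := []) (by simpa using h) hc).1
    cases this

end DetPushdown

/-- A deterministic one-pass machine that decides the language `L`: on every input it reaches the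
end-marker, without further `ε`-transitions, in a configuration that tells whether the input is
in `L`. -/
structure PassDecider (T Q Γ : Type*) (L : Language T) where
  /-- the transitions -/
  δ : Q → Option T → Option Γ → Option (Q × List Γ)
  /-- the initial state -/
  start : Q
  /-- the decision at the end-marker -/
  acc : Q → Option Γ → Prop
  deterministic : ∀ q γ, (δ q none γ).isSome → ∀ σ : T, δ q (some σ) γ = none
  total : ∀ q γ (σ : T), (δ q none γ).isSome ∨ (δ q (some σ) γ).isSome
  eps_empty : ∀ q, δ q none none = none
  decides : ∀ w, PassRun (fun q a γ q' ζ => δ q a γ = some (q', ζ))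
    (fun q γ => δ q none γ = none ∧ (acc q γ ↔ w ∈ L)) start [] w

namespace DetPushdown

variable {T Q Γ : Type*} (M : DetPushdown T Q Γ)

open Classical in
/-- The transitions of a machine deciding the language of `M`. It has an initial state `none`, a
dead state `some none`, and states `some (some (q, b))` for the simulation of `M`, where `b` records
whether `M` has been in a final state, before the current configuration, since it last read a
letter. Infinite sequences of `ε`-moves are cut off at a configuration below which they never pop
the stack. -/
noncomputable def deciderδ : Option (Option (Q × Prop)) → Option T → Option Γ →
    Option (Option (Option (Q × Prop)) × List Γ)
  | some (some (q, b)), none, some γ =>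
    if M.EpsTerminates (q, [γ]) then
      (M.δ q none γ).map fun z => (some (some (z.1, b ∨ q ∈ M.final)), z.2)
    else none
  | some (some (q, _)), some σ, some γ =>
    if M.EpsTerminates (q, [γ]) then
      if (M.δ q none γ).isSome then none
      else some ((M.δ q (some σ) γ).elim (some none, []) fun z => (some (some (z.1, False)), z.2))
    else some (some none, [])
  | some (some _), some _, none => some (some none, [])
  | some (some _), none, none => none
  | some none, some _, _ => some (some none, [])
  | some none, none, _ => none
  | none, some σ, _ =>
    some (if h : ∃ c : Q × List Γ, ∀ u, M.Accepts M.start [M.bottom] (σ :: u) ↔ M.Accepts c.1 c.2 u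
      then (some (some (h.choose.1, False)), h.choose.2) else (some none, []))
  | none, none, _ => none

/-- The decision at the end-marker. -/
def deciderAcc : Option (Option (Q × Prop)) → Option Γ → Prop
  | none, _ => [] ∈ M.language
  | some none, _ => False
  | some (some (q, b)), γ => b ∨ M.Accepts q γ.toList []

/-- From state `q`, with stack `s`, the decider comes to the decision `P` when reading `u`. -/
def DeciderRun (P : Prop) (q : Option (Option (Q × Prop))) (s : List Γ) (u : List T) : Prop :=
  PassRun (fun q a γ q' ζ => M.deciderδ q a γ = some (q', ζ))
    (fun q γ => M.deciderδ q none γ = none ∧ (M.deciderAcc q γ ↔ P)) q s u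

theorem deciderRun_dead {P : Prop} (hP : ¬ P) (s : List Γ) (u : List T) :
    M.DeciderRun P (some none) s u := by
  induction u generalizing s with
  | nil => exact .finish ⟨rfl, by simp [deciderAcc, hP]⟩
  | cons σ u ih => exact .read rfl (ih _)

/-- The configurations in which the decider makes no `ε`-move: the stack is empty, `M` itself has no
`ε`-move, or the `ε`-moves are cut off. Only shorter inputs remain after reading a letter, whence
`ih`. -/
theorem deciderRun_of_no_eps {P : Prop} {q : Q} {b : Prop} {s : List Γ} {u : List T}
    (ih : ∀ v, v.length < u.length → ∀ {q : Q} {b : Prop} {s : List Γ},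
      (P ↔ v = [] ∧ b ∨ M.Accepts q s v) → M.DeciderRun P (some (some (q, b))) s v)
    (hs : ∀ γ ∈ s.head?, M.EpsTerminates (q, [γ]) → M.δ q none γ = none)
    (hP : P ↔ u = [] ∧ b ∨ M.Accepts q s u) :
    M.DeciderRun P (some (some (q, b))) s u := by
  cases s with
  | nil =>
    cases u with
    | nil => exact .finish ⟨rfl, by simp [deciderAcc, hP]⟩
    | cons σ u =>
      refine .read rfl (M.deciderRun_dead ?_ _ u)
      simp [hP, accepts_empty_iff]
  | cons γ s =>
    have hs := hs γ rfl
    by_cases ht : M.EpsTerminates (q, [γ])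
    · have hn := hs ht
      cases u with
      | nil =>
        refine .finish ⟨?_, ?_⟩
        · simp [deciderδ, hn]
        · simp [deciderAcc, hP, accepts_nil_iff_of_no_eps hn]
      | cons σ u =>
        simp only [accepts_cons_iff_of_no_eps hn, reduceCtorEq, false_and, false_or] at hP
        cases hz : M.δ q (some σ) γ with
        | none =>
          refine .read (q' := some none) (ζ := []) (by simp [deciderδ, ht, hn, hz])
            (M.deciderRun_dead ?_ _ u)
          simp [hP, hz]
        | some z =>
          refine .read (q' := some (some (z.1, False))) (ζ := z.2)
            (by simp [deciderδ, ht, hn, hz]) (ih u (by simp) ?_)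
          simp [hP, hz]
    -- The cut-off case. What lies below `γ` is never reached, so the test at the end-marker may use
    -- `[γ]` alone, and any further letter means rejection.
    · have key {v : List T} : M.Accepts q (γ :: s) v → v = [] ∧ M.Accepts q [γ] [] :=
        fun h => h.of_not_epsTerminates (t := [γ]) ht
      cases u with
      | nil =>
        refine .finish ⟨?_, ?_⟩
        · simp [deciderδ, ht]
        · simp only [deciderAcc, hP, List.head?_cons, Option.toList_some, true_and]
          exact or_congr_right ⟨fun h => h.append s, fun h => (key h).2⟩
      | cons σ u =>
        refine .read (q' := some none) (ζ := []) (by simp [deciderδ, ht])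
          (M.deciderRun_dead ?_ _ u)
        rw [hP]
        rintro (⟨h, -⟩ | h)
        · cases h
        · cases (key h).1

/-- Three nested inductions, on the length of the input, on the stack, and on the terminating
`ε`-moves above the lower part of the stack, show that the decider never runs forever. -/
theorem deciderRun_simulation {P : Prop} (u : List T) {q : Q} {b : Prop} {s : List Γ}
    (hP : P ↔ u = [] ∧ b ∨ M.Accepts q s u) : M.DeciderRun P (some (some (q, b))) s u := by
  induction hu : u.length using Nat.strong_induction_on generalizing u q b s with
  | _ n ihu =>
    subst hu
    have ihu : ∀ v, v.length < u.length → ∀ {q : Q} {b : Prop} {s : List Γ},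
        (P ↔ v = [] ∧ b ∨ M.Accepts q s v) → M.DeciderRun P (some (some (q, b))) s v :=
      fun v hv q b s h => ihu _ hv v h rfl
    induction s generalizing q b with
    | nil => exact M.deciderRun_of_no_eps ihu (by simp) hP
    | cons γ s ihs =>
      by_cases ht : M.EpsTerminates (q, [γ])
      -- The part `c.2` above `s` evolves on its own; once it is used up, the induction hypothesis
      -- for `s` takes over.
      · suffices ∀ c, M.EpsTerminates c → ∀ {b : Prop},
            (P ↔ u = [] ∧ b ∨ M.Accepts c.1 (c.2 ++ s) u) →
              M.DeciderRun P (some (some (c.1, b))) (c.2 ++ s) u from this _ ht hP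
        intro c hc
        induction hc with
        | intro c _ ihc =>
          obtain ⟨q, t⟩ := c
          intro b hP
          cases t with
          | nil => exact ihs hP
          | cons γ t =>
            by_cases ht : M.EpsTerminates (q, [γ])
            · cases hz : M.δ q none γ with
              | none =>
                refine M.deciderRun_of_no_eps ihu ?_ hP
                rintro _ ⟨⟩ -
                exact hz
              | some z =>
                -- Being final now matters only if no letter remains. As the end-marker is read
                -- after the `ε`-moves, the flag must carry this along.
                have h1 := ihc (z.1, z.2 ++ t) ⟨γ, t, z.2, rfl, hz, rfl⟩
                  (b := b ∨ q ∈ M.final) (by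
                    rw [hP, List.cons_append, accepts_iff_of_eps hz, List.append_assoc]
                    tauto)
                refine .eps (q' := some (some (z.1, b ∨ q ∈ M.final))) (ζ := z.2)
                  (by simp [deciderδ, ht, hz]) ?_
                simpa [DeciderRun] using h1
            · refine M.deciderRun_of_no_eps ihu ?_ hP
              rintro _ ⟨⟩ h
              exact absurd h ht
      · refine M.deciderRun_of_no_eps ihu ?_ hP
        rintro _ ⟨⟩ h
        exact absurd h ht

/-- Every language accepted by a deterministic pushdown automaton is decided in one pass. -/
noncomputable def decider : PassDecider T (Option (Option (Q × Prop))) Γ M.language where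
  δ := M.deciderδ
  start := none
  acc := M.deciderAcc
  deterministic q γ h σ := by
    rcases q with _ | _ | ⟨q, b⟩
    · simp [deciderδ] at h
    · simp [deciderδ] at h
    · cases γ with
      | none => simp [deciderδ] at h
      | some γ =>
        by_cases ht : M.EpsTerminates (q, [γ])
        · simp only [deciderδ, ht, if_true, Option.isSome_map] at h ⊢
          simp [h]
        · simp [deciderδ, ht] at h
  total q γ σ := by
    rcases q with _ | _ | ⟨q, b⟩
    · simp [deciderδ]
    · simp [deciderδ]
    · cases γ with
      | none => simp [deciderδ]
      | some γ =>
        by_cases ht : M.EpsTerminates (q, [γ])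
        · cases hz : M.δ q none γ <;> simp [deciderδ, ht, hz]
        · simp [deciderδ, ht]
  eps_empty q := by rcases q with _ | _ | ⟨q, b⟩ <;> rfl
  decides w := by
    change M.DeciderRun (w ∈ M.language) none [] w
    cases w with
    | nil => exact .finish ⟨rfl, Iff.rfl⟩
    | cons σ w =>
      -- A pass starts with an empty stack and so cannot imitate `ε`-moves of `M` before the first
      -- letter `σ`. The configuration after `σ` depends on `σ` alone, so it is entered in a single
      -- move.
      by_cases h : ∃ c : Q × List Γ,
          ∀ u, M.Accepts M.start [M.bottom] (σ :: u) ↔ M.Accepts c.1 c.2 u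
      · refine .read (q' := some (some (h.choose.1, False))) (ζ := h.choose.2)
          (by simp [deciderδ, h]) (M.deciderRun_simulation w ?_)
        simpa [mem_language_iff_accepts] using h.choose_spec w
      · refine .read (q' := some none) (ζ := []) (by simp [deciderδ, h])
          (M.deciderRun_dead ?_ _ w)
        rw [mem_language_iff_accepts]
        exact (exists_read_letter σ (M.start, [M.bottom])).resolve_left h w

end DetPushdown

/-! ### Boolean combinations are deterministic multipass languages -/

/-- Needed for words outside the language: once a run halting in `reject` is exhibited, uniqueness
excludes an accepting one. -/
theorem DetMultipass.step_rightUnique {T Q Γ : Type*} {n : ℕ} (M : DetMultipass T Q Γ n)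
    (w : List T) : Relator.RightUnique (M.Step w) := by
  intro c c₁ c₂ h₁ h₂
  have key {j : Fin (n + 1)} {q : Q} {γ : Option Γ} {σ : T} {z z' : Q × List Γ}
      (h : M.δ j q none γ = some z) (h' : M.δ j q (some σ) γ = some z') : False := by
    have := M.deterministic j q γ (by simp [h]) σ
    cases this.symm.trans h'
  cases h₁ with
  | read h =>
    cases h₂ with
    | read h' => cases h.symm.trans h'; rfl
    | eps h' => exact (key h' h).elim
  | eps h =>
    cases h₂ with
    | read h' => exact (key h h').elim
    | eps h' => cases h.symm.trans h'; rfl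
    | nextPass h' => cases h.symm.trans h'
    | halt h' => cases h.symm.trans h'
  | @nextPass j q s h =>
    generalize hc : MultipassConfig.running j.castSucc q [] s = c at h₂
    cases h₂ with
    | read h' => simp at hc
    | eps h' =>
      obtain ⟨rfl, rfl, rfl, rfl⟩ := MultipassConfig.running.inj hc
      cases h.symm.trans h'
    | nextPass h' =>
      obtain ⟨hj, rfl, -, rfl⟩ := MultipassConfig.running.inj hc
      obtain rfl := Fin.castSucc_injective _ hj
      rfl
    | halt => exact absurd (MultipassConfig.running.inj hc).1 (Fin.castSucc_ne_last j)
  | @halt q s h =>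
    generalize hc : MultipassConfig.running (Fin.last n) q [] s = c at h₂
    cases h₂ with
    | read h' => simp at hc
    | eps h' =>
      obtain ⟨rfl, rfl, rfl, rfl⟩ := MultipassConfig.running.inj hc
      cases h.symm.trans h'
    | nextPass => exact absurd (MultipassConfig.running.inj hc).1.symm (Fin.castSucc_ne_last _)
    | halt h' =>
      obtain ⟨-, rfl, -, rfl⟩ := MultipassConfig.running.inj hc
      rfl

theorem DetMultipass.halted_unique {T Q Γ : Type*} {n : ℕ} (M : DetMultipass T Q Γ n)
    {w : List T} {c : MultipassConfig T Q Γ DetHalt n} {h h' : DetHalt}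
    (hc : Relation.ReflTransGen (M.Step w) c (.halted h))
    (hc' : Relation.ReflTransGen (M.Step w) c (.halted h')) : h = h' := by
  have final {h h' : DetHalt} (hh : Relation.ReflTransGen (M.Step w) (.halted h) (.halted h')) :
      h = h' := by
    rcases hh.cases_head with hh | ⟨_, hh, -⟩
    · exact MultipassConfig.halted.inj hh
    · cases hh
  rcases hc.total_of_right_unique (M.step_rightUnique w) hc' with hh | hh
  · exact final hh
  · exact (final hh).symm

section Combine

variable {T : Type*} {n : ℕ} {Q Γ : Fin (n + 1) → Type*} {F : Fin (n + 1) → Language T}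

/-- The set of languages known to contain the input, when the decider `x.2.1` has come to the
end-marker in state `x.2.2` with `γ` on top of the stack. -/
def PassDecider.record (D : ∀ i, PassDecider T (Q i) (Γ i) (F i))
    {A : Type*} (dec : ∀ i, A → Γ i) (x : Set (Fin (n + 1)) × Σ i, Q i) (γ : Option A) :
    Set (Fin (n + 1)) :=
  x.1 ∪ {i | i = x.2.1 ∧ (D x.2.1).acc x.2.2 (γ.map (dec x.2.1))}

open Classical in
/-- The multipass automaton that runs the decider `D j` on pass `j`, records the set of `j` for
which the input is in the language `F j`, and accepts if this set satisfies `φ`. -/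
noncomputable def PassDecider.combine (D : ∀ i, PassDecider T (Q i) (Γ i) (F i)) {A : Type*}
    (incl : T ↪ A) (enc : ∀ i, Γ i → A) (dec : ∀ i, A → Γ i) (φ : Set (Fin (n + 1)) → Prop) :
    DetMultipass T (Set (Fin (n + 1)) × Σ i, Q i) A n where
  incl := incl
  start := (∅, ⟨0, (D 0).start⟩)
  δ _ x a γ := ((D x.2.1).δ x.2.2 a (γ.map (dec x.2.1))).map fun z =>
    ((x.1, ⟨x.2.1, z.1⟩), z.2.map (enc x.2.1))
  deterministic j x γ h σ := by
    rw [Option.isSome_map] at h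
    rw [(D x.2.1).deterministic _ _ h σ, Option.map_none]
  total j x γ σ := by
    simp only [Option.isSome_map]
    exact (D x.2.1).total _ _ σ
  eps_empty j x := by rw [Option.map_none, (D x.2.1).eps_empty, Option.map_none]
  δNext j x γ := (PassDecider.record D dec x γ, ⟨j.succ, (D j.succ).start⟩)
  δLast x γ := if φ (PassDecider.record D dec x γ) then .accept else .reject

variable (D : ∀ i, PassDecider T (Q i) (Γ i) (F i)) {A : Type*} (incl : T ↪ A)
  {enc : ∀ i, Γ i → A} {dec : ∀ i, A → Γ i} (φ : Set (Fin (n + 1)) → Prop)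

/-- The recorded set `S` changes only at end-markers, so within a pass the decider's run is copied
symbol by symbol. -/
theorem PassDecider.combine_passRun (hdec : ∀ i x, dec i (enc i x) = x) (j i : Fin (n + 1))
    (S : Set (Fin (n + 1))) {fin : Q i → Option (Γ i) → Prop} {q : Q i} {s : List (Γ i)}
    {u : List T} (h : PassRun (fun q a γ q' ζ => (D i).δ q a γ = some (q', ζ)) fin q s u) :
    PassRun ((PassDecider.combine D incl enc dec φ).moves j)
      (fun x γ => ∃ q, x = (S, ⟨i, q⟩) ∧ fin q (γ.map (dec i))) (S, ⟨i, q⟩) (s.map (enc i)) u := by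
  have hs (s : List (Γ i)) : ((s.map (enc i)).head?).map (dec i) = s.head? := by
    cases s <;> simp [hdec]
  induction h with
  | finish h => exact .finish ⟨_, rfl, by rwa [hs]⟩
  | @read q q' σ s ζ u hd _ ih =>
    refine .read (q' := (S, ⟨i, q'⟩)) (ζ := ζ.map (enc i)) ?_ (by simpa using ih)
    simp [DetMultipass.moves, combine, funext (hdec i), Function.comp_def, hd]
  | @eps q q' s ζ u hd _ ih =>
    refine .eps (q' := (S, ⟨i, q'⟩)) (ζ := ζ.map (enc i)) ?_ (by simpa using ih)
    simp [DetMultipass.moves, combine, funext (hdec i), Function.comp_def, hd]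

open Classical in
-- The invariant is that at the start of pass `j` the recorded set is `{i | i < j ∧ w ∈ F i}`; since
-- every pass reaches its end-marker with the right decision, it propagates.
theorem PassDecider.combine_reaches (hdec : ∀ i x, dec i (enc i x) = x) (w : List T)
    (j : Fin (n + 1)) :
    Relation.ReflTransGen ((PassDecider.combine D incl enc dec φ).Step w)
      (.running j ({i | i < j ∧ w ∈ F i}, ⟨j, (D j).start⟩) w [])
      (.halted (if φ {i | w ∈ F i} then .accept else .reject)) := by
  induction j using Fin.reverseInduction with
  | last =>
    obtain ⟨_, s, ⟨q, rfl, hn, hacc⟩, h⟩ := DetMultipass.reaches_of_passRun _ (w := w)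
      (PassDecider.combine_passRun D incl φ hdec (Fin.last n) (Fin.last n)
        {i | i < Fin.last n ∧ w ∈ F i} ((D _).decides w))
    refine h.tail ?_
    have hrec : {i | w ∈ F i} = PassDecider.record D dec
        ({i | i < Fin.last n ∧ w ∈ F i}, ⟨Fin.last n, q⟩) s.head? := by
      ext i
      simp only [record, hacc, Set.mem_union, Set.mem_ofPred_eq]
      rcases (Fin.le_last i).eq_or_lt with rfl | hi
      · simp
      · simp [hi, hi.ne]
    rw [hrec]
    exact .halt (by simp [combine, hn])
  | cast j ih =>
    obtain ⟨_, s, ⟨q, rfl, hn, hacc⟩, h⟩ := DetMultipass.reaches_of_passRun _ (w := w)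
      (PassDecider.combine_passRun D incl φ hdec j.castSucc j.castSucc
        {i | i < j.castSucc ∧ w ∈ F i} ((D _).decides w))
    refine h.trans (.head (.nextPass (by simp [combine, hn])) ?_)
    have hrec : {i | i < j.succ ∧ w ∈ F i} = PassDecider.record D dec
        ({i | i < j.castSucc ∧ w ∈ F i}, ⟨j.castSucc, q⟩) s.head? := by
      ext i
      simp only [record, hacc, Set.mem_union, Set.mem_ofPred_eq]
      rw [← Fin.le_castSucc_iff, le_iff_eq_or_lt]
      constructor
      · rintro ⟨rfl | hi, hw⟩
        · exact .inr ⟨rfl, hw⟩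
        · exact .inl ⟨hi, hw⟩
      · rintro (⟨hi, hw⟩ | ⟨rfl, hw⟩)
        · exact ⟨.inr hi, hw⟩
        · exact ⟨.inl rfl, hw⟩
    rw [hrec] at ih
    exact ih

theorem PassDecider.mem_language_combine (hdec : ∀ i x, dec i (enc i x) = x) (w : List T) :
    w ∈ (PassDecider.combine D incl enc dec φ).language ↔ φ {i | w ∈ F i} := by
  classical
  have h := PassDecider.combine_reaches D incl φ hdec w 0
  have h0 : {i : Fin (n + 1) | i < 0 ∧ w ∈ F i} = ∅ := by simp
  rw [h0] at h
  constructor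
  · intro hw
    by_contra hφ
    rw [if_neg hφ] at h
    cases DetMultipass.halted_unique _ hw h
  · intro hφ
    rw [if_pos hφ] at h
    exact h

end Combine

theorem isDetMultipass_of_isDetContextFree {T : Type*} [Finite T] {ι : Type*} [Finite ι]
    [Nonempty ι] {F : ι → Language T} (hF : ∀ i, IsDetContextFree (F i)) (φ : Set ι → Prop)
    {L : Language T} (hL : ∀ w, w ∈ L ↔ φ {i | w ∈ F i}) : IsDetMultipass L := by
  obtain ⟨n, ⟨e⟩⟩ := Finite.exists_equiv_fin ι
  obtain ⟨n, rfl⟩ : ∃ m, n = m + 1 := by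
    obtain ⟨i⟩ := ‹Nonempty ι›
    cases n with
    | zero => exact (e i).elim0
    | succ m => exact ⟨m, rfl⟩
  obtain ⟨k, ⟨eT⟩⟩ := Finite.exists_equiv_fin T
  choose Q Γ _ _ M hM using fun i => hF (e.symm i)
  -- Decoding by `Function.invFun` needs a default symbol.
  have hΓ : ∀ i, Nonempty (Γ i) := fun i => ⟨(M i).bottom⟩
  let enc (i) (x : Γ i) : Fin k ⊕ Σ i, Γ i := .inr ⟨i, x⟩
  have henc (i) : Function.Injective (enc i) := fun x y h => by simpa [enc] using h
  refine ⟨n, _, Fin k ⊕ Σ i, Γ i, inferInstance, inferInstance,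
    PassDecider.combine (fun i => (M i).decider) (eT.toEmbedding.trans .inl) enc
      (fun i => Function.invFun (enc i)) (fun S => φ (e ⁻¹' S)), Language.ext fun w => ?_⟩
  rw [PassDecider.mem_language_combine _ _ _ (fun i => Function.leftInverse_invFun (henc i)), hL]
  simp [hM]

theorem isDetContextFree_bot {T : Type*} : IsDetContextFree (⊥ : Language T) :=
  ⟨Unit, Unit, inferInstance, inferInstance,
    { δ := fun _ _ _ => none, start := (), bottom := (), final := ∅, deterministic := by simp },
    Language.ext fun w => ⟨fun ⟨_, hq, _⟩ => hq.elim, False.elim⟩⟩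

/-- Each member of the closure is a condition `φ` on which of finitely many deterministic
context-free languages contain the word. This form survives complements by negating `φ`, and unions
by joining the index sets. -/
theorem isDetMultipass_of_mem_closure {T : Type*} [Finite T] {L : Language T}
    (hL : L ∈ BooleanSubalgebra.closure {L : Language T | IsDetContextFree L}) :
    IsDetMultipass L := by
  suffices ∃ (ι : Type) (_ : Finite ι) (_ : Nonempty ι) (F : ι → Language T) (φ : Set ι → Prop),
      (∀ i, IsDetContextFree (F i)) ∧ ∀ w, w ∈ L ↔ φ {i | w ∈ F i} by
    obtain ⟨ι, _, _, F, φ, hF, hL⟩ := this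
    exact isDetMultipass_of_isDetContextFree hF φ hL
  induction hL using BooleanSubalgebra.closure_bot_sup_induction with
  | mem L hL =>
    exact ⟨Unit, inferInstance, inferInstance, fun _ => L, fun S => () ∈ S, fun _ => hL,
      fun w => Iff.rfl⟩
  | bot =>
    exact ⟨Unit, inferInstance, inferInstance, fun _ => ⊥, fun _ => False,
      fun _ => isDetContextFree_bot, fun w => Iff.rfl⟩
  | sup L _ L' _ ih ih' =>
    obtain ⟨ι, _, _, F, φ, hF, hL⟩ := ih
    obtain ⟨ι', _, _, F', φ', hF', hL'⟩ := ih'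
    exact ⟨ι ⊕ ι', inferInstance, inferInstance, Sum.elim F F',
      fun S => φ (Sum.inl ⁻¹' S) ∨ φ' (Sum.inr ⁻¹' S), Sum.forall.2 ⟨hF, hF'⟩,
      fun w => or_congr (hL w) (hL' w)⟩
  | compl L _ ih =>
    obtain ⟨ι, _, _, F, φ, hF, hL⟩ := ih
    exact ⟨ι, inferInstance, inferInstance, F, fun S => ¬ φ S, hF, fun w => not_congr (hL w)⟩

theorem mainTheorem1 {T : Type*} [Finite T] :
    {L : Language T | IsDetMultipass L} =
        (BooleanSubalgebra.closure {L : Language T | IsDetContextFree L} : Set (Language T)) ∧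
      {L : Language T | IsNondetMultipass L} = {L : Language T | IsPolyContextFree L} :=
  ⟨Set.ext fun _ => ⟨IsDetMultipass.mem_closure, isDetMultipass_of_mem_closure⟩,
    Set.ext fun _ => ⟨IsNondetMultipass.isPolyContextFree, IsPolyContextFree.isNondetMultipass⟩⟩
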